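/- Let $q$ be a prime power and let $k\ge 2$, $t\ge 1$ be integers. Let $\mathcal A$ be an arc of size $q+k-1-t$ in $\mathrm{PG}(k-1,q)$, i.e. a set of points no $k$ of which lie in a hyperplane (if $|\mathcal A|<k$, assume moreover that the points of $\mathcal A$ are linearly independent). Order $\mathcal A$ arbitrarily and identify each of its points with a fixed vector representative in $\mathbb F_q^k$. Let $\Phi_t[X]$ be the space of homogeneous polynomials of degree $t$ in $X=(X_1,\ldots,X_k)$ over $\mathbb F_q$ that vanish on $\mathcal A$. For a $(k-2)$-subset $S$ of $\mathcal A$, the tangent $S$-hyperplanes are the hyperplanes meeting $\mathcal A$ exactly in $S$, and $f_S(X)$ denotes a nonzero scalar multiple of the product of linear forms whose kernels are the tangent $S$-hyperplanes, each taken once. Let $E$ be the set of the first $k-2$ points of $\mathcal A$. The scalars are chosen such that, for every $(k-2)$-subset $S\ne E$, $$f_S(e)=(-1)^{s(t+1)}f_{(S\cup\{e\})\setminus\{a\}}(a),$$ where $e$ is the first element of $E\setminus S$, $a$ is the last element of $S\setminus E$, and $s$ is the parity of the permutation which orders, as in $\mathcal A$, the sequence consisting of $S$ (in the order of $\mathcal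 A$) followed by $e$. Such a family $(f_S)_S$ exists, and for every such family the following holds. There is a polynomial $F(Y_1,\ldots,Y_{k-1})$ over $\mathbb F_q$ in $k(k-1)$ variables, where $Y_j=(X_{j1},\ldots,X_{jk})$, homogeneous of degree $t$ in each of the $k$-tuples $Y_j$, such that: (i) For every $(k-2)$-subset $S$ of $\mathcal A$ and every listing $a_1,\ldots,a_{k-2}$ of its elements, $$F(a_1,\ldots,a_{k-2},X)\equiv(-1)^{s(t+1)}f_S(X)\pmod{\Phi_t[X]},$$ where $s$ is the parity of the permutation which orders $(a_1,\ldots,a_{k-2})$ as in the ordering of $\mathcal A$. (ii) For every sequence $a_1,\ldots,a_{k-1}$ of elements of $\mathcal A$ in which some point is repeated, $F(a_1,\ldots,a_{k-1})=0$. (iii) For every $\sigma\in\mathrm{Sym}(k-1)$, $$F(Y_{\sigma(1)},\ldots,Y_{\sigma(k-1)})\equiv(-1)^{s(t+1)}F(Y_1,\ldots,Y_{k-1})$$ modulo the ideal generated by $\Phi_t[Y_1],\ldots,\Phi_t[Y_{k-1}]$, where $s$ is the parity of $\sigma$. (iv) Any two polynomials that are homogeneous of degree $t$ in each $Y_j$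 and satisfy (i), (ii) and (iii) are congruent modulo the ideal generated by $\Phi_t[Y_1],\ldots,\Phi_t[Y_{k-1}]$. -/

import Mathlib

open scoped LinearAlgebra.Projectivization

/-!
Throughout, `k = r + 2`, so that points of `PG(k-1, q)` are the points of `ℙ K (Fin (r + 2) → K)`
with `q = |K|`, a `(k-2)`-subset is a set of size `r`, and a `(k-1)`-tuple is indexed by
`Fin (r + 1)`.  The points of an arc are listed in a fixed order, with a fixed vector
representative `a i` for the `i`-th point; subsets of the arc are given by their index sets.
-/

namespace Arc

variable {K : Type*} [Field K] {r n : ℕ}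

/-- An arc of `PG(k-1, q)`: a set of points no `k` of which are contained in a hyperplane. -/
def IsArc (A : Set (ℙ K (Fin (r + 2) → K))) : Prop :=
  ∀ B : Finset (ℙ K (Fin (r + 2) → K)), (B : Set (ℙ K (Fin (r + 2) → K))) ⊆ A →
    B.card = r + 2 →
    ∀ H : Submodule K (Fin (r + 2) → K), Module.finrank K H = r + 1 →
      ¬ ∀ P ∈ B, P.submodule ≤ H

/-- `Φ_t[X]`: the forms of degree `t` vanishing at all points of the arc. -/
noncomputable def Phi (a : Fin n → Fin (r + 2) → K) (t : ℕ) :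
    Submodule K (MvPolynomial (Fin (r + 2)) K) :=
  MvPolynomial.homogeneousSubmodule (Fin (r + 2)) K t ⊓
    ⨅ i, LinearMap.ker (MvPolynomial.aeval (R := K) (a i)).toLinearMap

/-- The tangent `S`-hyperplanes: hyperplanes meeting the arc exactly in `S`. -/
noncomputable def tangentHyperplanes [Finite K] (a : Fin n → Fin (r + 2) → K)
    (S : Finset (Fin n)) : Finset (Submodule K (Fin (r + 2) → K)) :=
  (Set.toFinite {H : Submodule K (Fin (r + 2) → K) |
    Module.finrank K H = r + 1 ∧ ∀ i, a i ∈ H ↔ i ∈ S}).toFinset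

/-- `f` is a nonzero scalar multiple of a product of linear forms whose kernels are the tangent
`S`-hyperplanes, each taken once. -/
def IsTangentForm [Finite K] (a : Fin n → Fin (r + 2) → K) (S : Finset (Fin n))
    (f : MvPolynomial (Fin (r + 2)) K) : Prop :=
  ∃ (c : K) (α : Submodule K (Fin (r + 2) → K) → MvPolynomial (Fin (r + 2)) K),
    c ≠ 0 ∧
    (∀ H ∈ tangentHyperplanes a S, (α H).IsHomogeneous 1 ∧
      ∀ x : Fin (r + 2) → K, MvPolynomial.eval x (α H) = 0 ↔ x ∈ H) ∧
    f = MvPolynomial.C c * ∏ H ∈ tangentHyperplanes a S, α H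

/-- The sign `(-1)^s`, where `s` is the parity of the permutation which puts the entries of the
sequence `τ` in increasing order. -/
def orderSign {m : ℕ} (τ : Fin m → Fin n) : ℤˣ :=
  Equiv.Perm.sign (Tuple.sort τ)

/-- The set `E` of the first `k - 2` points of the arc. -/
def firstPoints (r n : ℕ) : Finset (Fin n) :=
  Finset.univ.filter fun i => (i : ℕ) < r

/-- A family of tangent forms `f S`, one for each `(k-2)`-subset `S`, scaled by
`f_S(e) = (-1)^{s(t+1)} f_{S ∪ {e} \ {b}}(b)`, where `e` is the first element of `E \ S`, `b` is
the last element of `S \ E`, and `s` is the parity of the permutation which orders the sequence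
consisting of `S` (in increasing order) followed by `e`. -/
structure IsScaledTangentFamily [Finite K] (a : Fin n → Fin (r + 2) → K) (t : ℕ)
    (f : Finset (Fin n) → MvPolynomial (Fin (r + 2)) K) : Prop where
  tangent : ∀ S : Finset (Fin n), S.card = r → IsTangentForm a S (f S)
  scaled : ∀ (S : Finset (Fin n)) (hS : S.card = r) (e b : Fin n),
    IsLeast {i | i ∈ firstPoints r n ∧ i ∉ S} e →
    IsGreatest {i | i ∈ S ∧ i ∉ firstPoints r n} b →
    MvPolynomial.eval (a e) (f S) =
      ((orderSign (Fin.snoc (α := fun _ => Fin n) (S.orderEmbOfFin hS) e) : ℤ) : K) ^ (t + 1) *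
        MvPolynomial.eval (a b) (f (insert e (S.erase b)))

/-- Polynomials `F(Y_1, …, Y_{k-1})`; the variable `(j, i)` is the `i`-th entry of `Y_j`. -/
abbrev TuplePoly (K : Type*) [Field K] (r : ℕ) : Type _ :=
  MvPolynomial (Fin (r + 1) × Fin (r + 2)) K

/-- `F` is homogeneous of degree `t` in each of the tuples `Y_j`. -/
def IsMultiHomogeneous (F : TuplePoly K r) (t : ℕ) : Prop :=
  ∀ j : Fin (r + 1),
    MvPolynomial.IsWeightedHomogeneous
      (fun p : Fin (r + 1) × Fin (r + 2) => if p.1 = j then 1 else 0) F t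

/-- `F(y_1, …, y_{k-2}, X)`, a polynomial in `X`. -/
noncomputable def evalInit (y : Fin r → Fin (r + 2) → K) (F : TuplePoly K r) :
    MvPolynomial (Fin (r + 2)) K :=
  MvPolynomial.aeval
    (fun p : Fin (r + 1) × Fin (r + 2) =>
      Fin.snoc (α := fun _ => Fin (r + 2) → MvPolynomial (Fin (r + 2)) K)
        (fun j i => MvPolynomial.C (y j i)) MvPolynomial.X p.1 p.2) F

/-- `F(y_1, …, y_{k-1})`, a scalar. -/
noncomputable def evalAll (y : Fin (r + 1) → Fin (r + 2) → K) (F : TuplePoly K r) : K :=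
  MvPolynomial.eval (fun p => y p.1 p.2) F

/-- `F(Y_{σ(1)}, …, Y_{σ(k-1)})`. -/
noncomputable def permute (σ : Equiv.Perm (Fin (r + 1))) (F : TuplePoly K r) : TuplePoly K r :=
  MvPolynomial.rename (fun p => (σ p.1, p.2)) F

/-- The ideal generated by `Φ_t[Y_1], …, Φ_t[Y_{k-1}]`. -/
noncomputable def PhiIdeal (a : Fin n → Fin (r + 2) → K) (t : ℕ) : Ideal (TuplePoly K r) :=
  Ideal.span {P | ∃ j : Fin (r + 1), ∃ φ ∈ Phi a t, P = MvPolynomial.rename (fun i => (j, i)) φ}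

/-- The forms `F(Y_1, …, Y_{k-1})`, homogeneous of degree `t` in each `Y_j`, that have the three
properties (i), (ii), (iii) with respect to the family `f` of tangent forms. -/
structure IsTensorForm (a : Fin n → Fin (r + 2) → K) (t : ℕ)
    (f : Finset (Fin n) → MvPolynomial (Fin (r + 2)) K) (F : TuplePoly K r) : Prop where
  homogeneous : IsMultiHomogeneous F t
  eval_subset : ∀ τ : Fin r → Fin n, Function.Injective τ →
    evalInit (fun j => a (τ j)) F -
      MvPolynomial.C (((orderSign τ : ℤ) : K) ^ (t + 1)) * f (Finset.univ.image τ) ∈ Phi a t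
  eval_repeated : ∀ τ : Fin (r + 1) → Fin n, ¬ Function.Injective τ →
    evalAll (fun j => a (τ j)) F = 0
  permute_args : ∀ σ : Equiv.Perm (Fin (r + 1)),
    permute σ F - MvPolynomial.C (((Equiv.Perm.sign σ : ℤ) : K) ^ (t + 1)) * F ∈ PhiIdeal a t

end Arc

/-! Write `k = r + 2`. Modulo the ideal generated by the `Phi a t` in the separate blocks of
variables, a polynomial that is homogeneous of degree `t` in each block is determined by its values
at the tuples of arc points (`IsMultiHomogeneous.mem_PhiIdeal`). Properties (i) and (ii) prescribe
all these values, namely `tangentArray`; uniqueness follows at once.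

For existence, take forms `g i` that reproduce every form of degree `t` from its values on the arc,
and put `F = ∑ c_τ ∏ g_{τ j}(Y_j)`, where `c` is the prescribed array. This `F` has the values `c`
as soon as each slice of `c`, in which a single index varies, is the list of values of some form of
degree `t` (`evalAll_tensorSum`). In the last slot the form is a signed tangent form. The other
slots are reduced to the last by the symmetry of `c` under permutations up to `sign ^ (t + 1)`,
which also gives (iii).

The symmetry says that, for a set `C` of `k - 1` arc points, the signed value of `f_{C \ {x}}` at
`x` does not depend on `x ∈ C`. Segre's lemma of tangents gives a cyclic relation between such
values, and the scaling gives one equality for each `S ≠ E`, along an exchange that moves `S`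
towards `E`. Induction on the number of points outside `E` yields all the equalities
(`eq_of_cyclic_of_exchange`). -/

namespace Arc

open MvPolynomial

/-! ### Interpolation on the arc and multihomogeneous forms modulo the ideal -/

section Interpolation

variable {K : Type*} [Field K] {r n t : ℕ} {a : Fin n → Fin (r + 2) → K}

theorem mem_Phi {φ : MvPolynomial (Fin (r + 2)) K} :
    φ ∈ Phi a t ↔ φ.IsHomogeneous t ∧ ∀ i, eval (a i) φ = 0 := by
  simp [Phi, Submodule.mem_iInf, aeval_eq_eval]

/-- Forms which interpolate the values at the arc of any form of degree `t`. -/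
theorem exists_interpolating_forms (a : Fin n → Fin (r + 2) → K) (t : ℕ) :
    ∃ g : Fin n → MvPolynomial (Fin (r + 2)) K, (∀ i, (g i).IsHomogeneous t) ∧
      ∀ φ : MvPolynomial (Fin (r + 2)) K, φ.IsHomogeneous t →
        φ - ∑ i, C (eval (a i) φ) * g i ∈ Phi a t := by
  let V := homogeneousSubmodule (Fin (r + 2)) K t
  let ev : V →ₗ[K] (Fin n → K) :=
    (LinearMap.pi fun i => (aeval (R := K) (a i)).toLinearMap) ∘ₗ V.subtype
  -- A section of the evaluation map over its range is extended to all of `Fin n → K`; the forms are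
  -- the images of the unit vectors. They need not be dual to the points: only value vectors of
  -- actual forms are reproduced.
  obtain ⟨ψ, hψ⟩ := ev.rangeRestrict.exists_rightInverse_of_surjective
    (LinearMap.range_eq_top.2 ev.surjective_rangeRestrict)
  obtain ⟨ψ', hψ'⟩ := LinearMap.exists_extend ψ
  refine ⟨fun i => (ψ' (Pi.single i 1) : V), fun i => (ψ' (Pi.single i 1)).2, fun φ hφ => ?_⟩
  have key : ev (ψ' (ev ⟨φ, hφ⟩)) = ev ⟨φ, hφ⟩ := by
    have h1 := LinearMap.congr_fun hψ' (ev.rangeRestrict ⟨φ, hφ⟩)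
    have h2 := congrArg Subtype.val (LinearMap.congr_fun hψ (ev.rangeRestrict ⟨φ, hφ⟩))
    simp only [LinearMap.comp_apply, Submodule.subtype_apply, LinearMap.id_apply] at h1 h2
    rw [← h1] at h2
    exact h2
  have hsum : (∑ i, C (eval (a i) φ) * (ψ' (Pi.single i 1)).1 : MvPolynomial (Fin (r + 2)) K)
      = (ψ' (ev ⟨φ, hφ⟩)).1 := by
    conv_rhs => rw [pi_eq_sum_univ' (ev ⟨φ, hφ⟩), map_sum]
    rw [AddSubmonoidClass.coe_finsetSum]
    refine Finset.sum_congr rfl fun i _ => ?_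
    rw [map_smul, Submodule.coe_smul, smul_eq_C_mul]
    congr 2
  rw [hsum, mem_Phi]
  refine ⟨(homogeneousSubmodule (Fin (r + 2)) K t).sub_mem hφ (ψ' (ev ⟨φ, hφ⟩)).2, fun i => ?_⟩
  have := congrFun key i
  simp only [ev, LinearMap.comp_apply, LinearMap.pi_apply, Submodule.subtype_apply,
    AlgHom.toLinearMap_apply, aeval_eq_eval] at this
  rw [map_sub, sub_eq_zero]
  exact this.symm

/-- The polynomial `∑_τ c_τ ∏_j g_{τ j}(Y_j)`. -/
noncomputable def tensorSum (g : Fin n → MvPolynomial (Fin (r + 2)) K)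
    (c : (Fin (r + 1) → Fin n) → K) : TuplePoly K r :=
  ∑ τ : Fin (r + 1) → Fin n, C (c τ) * ∏ j, rename (fun i => (j, i)) (g (τ j))

theorem prod_rename_monomial (d : Fin (r + 1) × Fin (r + 2) →₀ ℕ) (c : K) :
    monomial d c = C c * ∏ j, rename (fun i => (j, i))
      (∏ i, (X i : MvPolynomial (Fin (r + 2)) K) ^ d (j, i)) := by
  rw [monomial_eq, Finsupp.prod_fintype _ _ (by simp), Fintype.prod_prod_type]
  simp

/-- By linearity `F` may be taken to be a monomial, that is, a product of forms of degree `t`, one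
in each block. Each factor is congruent to its interpolant, and the product of the interpolants
expands into the sum over `τ`. -/
theorem IsMultiHomogeneous.sub_tensorSum_mem {F : TuplePoly K r} (hF : IsMultiHomogeneous F t)
    {g : Fin n → MvPolynomial (Fin (r + 2)) K}
    (hg : ∀ φ : MvPolynomial (Fin (r + 2)) K, φ.IsHomogeneous t →
        φ - ∑ i, C (eval (a i) φ) * g i ∈ Phi a t) :
    F - tensorSum g (fun τ => evalAll (fun j => a (τ j)) F) ∈ PhiIdeal a t := by
  have hsub : F - tensorSum g (fun τ => evalAll (fun j => a (τ j)) F) =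
      ∑ d ∈ F.support, (monomial d (coeff d F) -
        tensorSum g (fun τ => evalAll (fun j => a (τ j)) (monomial d (coeff d F)))) := by
    rw [Finset.sum_sub_distrib, support_sum_monomial_coeff]
    congr 1
    simp only [tensorSum]
    rw [Finset.sum_comm]
    refine Finset.sum_congr rfl fun τ _ => ?_
    rw [← Finset.sum_mul, ← map_sum]
    congr 2
    conv_lhs => rw [← support_sum_monomial_coeff F]
    simp only [evalAll, map_sum]
  rw [hsub]
  refine Ideal.sum_mem _ fun d hd => ?_
  set m : Fin (r + 1) → MvPolynomial (Fin (r + 2)) K := fun j => ∏ i, X i ^ d (j, i) with hm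
  have hmh : ∀ j, (m j).IsHomogeneous t := by
    intro j
    have h1 := IsHomogeneous.prod Finset.univ
      (fun i => (X i : MvPolynomial (Fin (r + 2)) K) ^ d (j, i)) (fun i => d (j, i))
      (fun i _ => isHomogeneous_X_pow i _)
    have h2 := hF j (mem_support_iff.1 hd)
    rw [Finsupp.weight_apply, Finsupp.sum_fintype _ _ (by simp), Fintype.sum_prod_type] at h2
    simp only [smul_eq_mul, mul_ite, mul_one, mul_zero] at h2
    rw [Finset.sum_eq_single j (by intro b _ hb; simp [hb]) (by simp)] at h2
    simp only [if_true] at h2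
    rwa [h2] at h1
  rw [← Ideal.Quotient.eq_zero_iff_mem, map_sub, sub_eq_zero]
  have hslot : ∀ j, Ideal.Quotient.mk (PhiIdeal a t) (rename (fun i => (j, i)) (m j)) =
      ∑ i, Ideal.Quotient.mk (PhiIdeal a t)
        (C (eval (a i) (m j)) * rename (fun i => (j, i)) (g i)) := by
    intro j
    rw [← map_sum, Ideal.Quotient.eq]
    refine Ideal.subset_span ⟨j, _, hg _ (hmh j), ?_⟩
    simp
  rw [prod_rename_monomial, map_mul, map_prod, Finset.prod_congr rfl (fun j _ => hslot j),
    Fintype.prod_sum, tensorSum, map_sum, Finset.mul_sum]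
  refine Finset.sum_congr rfl fun τ _ => ?_
  simp only [map_mul, Finset.prod_mul_distrib, map_prod, ← mul_assoc]
  congr 1
  simp only [evalAll, map_mul, map_prod, eval_C, eval_rename, m]
  rfl

/-- This reduces the congruences in (iii) and (iv) to equalities of values at arc points. -/
theorem IsMultiHomogeneous.mem_PhiIdeal {F : TuplePoly K r} (hF : IsMultiHomogeneous F t)
    (h0 : ∀ τ : Fin (r + 1) → Fin n, evalAll (fun j => a (τ j)) F = 0) : F ∈ PhiIdeal a t := by
  obtain ⟨g, -, hg⟩ := exists_interpolating_forms a t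
  simpa [h0, tensorSum] using hF.sub_tensorSum_mem hg

theorem isWeightedHomogeneous_rename {φ : MvPolynomial (Fin (r + 2)) K} (hφ : φ.IsHomogeneous t)
    (j j' : Fin (r + 1)) :
    IsWeightedHomogeneous (fun p : Fin (r + 1) × Fin (r + 2) => if p.1 = j' then 1 else 0)
      (rename (fun i => (j, i)) φ) (if j = j' then t else 0) := by
  rw [← support_sum_monomial_coeff φ, map_sum]
  refine (weightedHomogeneousSubmodule K _ _).sum_mem fun d hd => ?_
  rw [mem_weightedHomogeneousSubmodule, rename_monomial]
  refine isWeightedHomogeneous_monomial _ _ _ ?_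
  have h2 := hφ (mem_support_iff.1 hd)
  rw [Finsupp.weight_apply, Finsupp.sum_mapDomain_index (by simp) (by intros; rw [add_smul])]
  rw [Finsupp.weight_apply] at h2
  split_ifs with h
  · simpa [h] using h2
  · simp

theorem isMultiHomogeneous_tensorSum {g : Fin n → MvPolynomial (Fin (r + 2)) K}
    (hg : ∀ i, (g i).IsHomogeneous t) (c : (Fin (r + 1) → Fin n) → K) :
    IsMultiHomogeneous (tensorSum g c) t := by
  intro j'
  refine (weightedHomogeneousSubmodule K _ _).sum_mem fun τ _ => ?_
  rw [mem_weightedHomogeneousSubmodule]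
  have h1 := IsWeightedHomogeneous.prod Finset.univ
    (fun j => rename (fun i => (j, i)) (g (τ j))) (fun j => if j = j' then t else 0)
    (fun j _ => isWeightedHomogeneous_rename (hg (τ j)) j j')
  have h2 := (isWeightedHomogeneous_C
    (fun p : Fin (r + 1) × Fin (r + 2) => if p.1 = j' then 1 else 0) (c τ)).mul h1
  simpa using h2

theorem IsMultiHomogeneous.permute {F : TuplePoly K r} (hF : IsMultiHomogeneous F t)
    (σ : Equiv.Perm (Fin (r + 1))) : IsMultiHomogeneous (permute σ F) t := by
  intro j
  rw [Arc.permute, ← support_sum_monomial_coeff F, map_sum]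
  refine (weightedHomogeneousSubmodule K _ _).sum_mem fun d hd => ?_
  rw [mem_weightedHomogeneousSubmodule, rename_monomial]
  refine isWeightedHomogeneous_monomial _ _ _ ?_
  have h2 := hF (σ.symm j) (mem_support_iff.1 hd)
  rw [Finsupp.weight_apply, Finsupp.sum_mapDomain_index (by simp) (by intros; rw [add_smul])]
  rw [Finsupp.weight_apply] at h2
  simpa [Equiv.eq_symm_apply] using h2

theorem IsMultiHomogeneous.sub_C_mul {F G : TuplePoly K r} (hF : IsMultiHomogeneous F t)
    (hG : IsMultiHomogeneous G t) (c : K) : IsMultiHomogeneous (F - C c * G) t := by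
  intro j
  rw [← smul_eq_C_mul]
  exact (weightedHomogeneousSubmodule K _ _).sub_mem (hF j)
    ((weightedHomogeneousSubmodule K _ _).smul_mem _ (hG j))

theorem evalAll_permute (σ : Equiv.Perm (Fin (r + 1))) (F : TuplePoly K r)
    (y : Fin (r + 1) → Fin (r + 2) → K) :
    evalAll y (permute σ F) = evalAll (fun j => y (σ j)) F := by
  simp only [evalAll, permute, eval_rename]
  rfl

theorem eval_evalInit (y : Fin r → Fin (r + 2) → K) (x : Fin (r + 2) → K) (F : TuplePoly K r) :
    eval x (evalInit y F) =
      evalAll (Fin.snoc (α := fun _ => Fin (r + 2) → K) y x) F := by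
  rw [evalInit, evalAll, ← aeval_eq_eval, ← AlgHom.comp_apply, comp_aeval, ← aeval_eq_eval]
  congr 2
  funext p
  obtain ⟨j, i⟩ := p
  refine Fin.lastCases ?_ (fun j => ?_) j <;> simp

/-- Specialising the first `r` blocks turns every factor but the last into a scalar. -/
theorem isHomogeneous_evalInit_tensorSum {g : Fin n → MvPolynomial (Fin (r + 2)) K}
    (hg : ∀ i, (g i).IsHomogeneous t) (c : (Fin (r + 1) → Fin n) → K)
    (y : Fin r → Fin (r + 2) → K) : (evalInit y (tensorSum g c)).IsHomogeneous t := by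
  rw [evalInit, tensorSum, map_sum]
  refine (homogeneousSubmodule _ K t).sum_mem fun τ _ => ?_
  rw [mem_homogeneousSubmodule, map_mul, map_prod, Fin.prod_univ_castSucc, ← mul_assoc]
  have hlast : aeval (fun p : Fin (r + 1) × Fin (r + 2) =>
      Fin.snoc (α := fun _ => Fin (r + 2) → MvPolynomial (Fin (r + 2)) K)
        (fun j i => C (y j i)) X p.1 p.2)
      (rename (fun i => (Fin.last r, i)) (g (τ (Fin.last r)))) = g (τ (Fin.last r)) := by
    rw [aeval_rename]
    simp [Function.comp_def]
  have hinit : ∀ j : Fin r, aeval (fun p : Fin (r + 1) × Fin (r + 2) =>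
      Fin.snoc (α := fun _ => Fin (r + 2) → MvPolynomial (Fin (r + 2)) K)
        (fun j i => C (y j i)) X p.1 p.2)
      (rename (fun i => (j.castSucc, i)) (g (τ j.castSucc))) =
        C (eval (y j) (g (τ j.castSucc))) := by
    intro j
    rw [aeval_rename]
    simp only [Function.comp_def, Fin.snoc_castSucc]
    rw [aeval_def, algebraMap_eq, show (fun x => C (y j x)) = C ∘ y j from rfl, eval₂_comp]
  rw [hlast, Finset.prod_congr rfl (fun j _ => hinit j), ← map_prod, aeval_C, algebraMap_eq,
    ← C_mul, ← smul_eq_C_mul]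
  exact (homogeneousSubmodule _ K t).smul_mem _ (hg _)

/-- An array each of whose slices is fixed by a matrix `M` is fixed by the tensor power of `M`. -/
theorem sum_prod_mul_eq_of_slices {ι : Type*} [Fintype ι] [DecidableEq ι] (M : ι → ι → K) :
    ∀ (m : ℕ) (c : (Fin m → ι) → K),
      (∀ j τ, ∑ l, M (τ j) l * c (Function.update τ j l) = c τ) →
      ∀ τ', ∑ τ, c τ * ∏ j, M (τ' j) (τ j) = c τ'
  | 0, c, _, τ' => by
    simp [Subsingleton.elim default τ']
  | m + 1, c, hc, τ' => by
    rw [← (Fin.consEquiv (fun _ => ι)).sum_comp, Fintype.sum_prod_type]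
    simp only [Fin.consEquiv, Equiv.coe_fn_mk, Fin.prod_univ_succ, Fin.cons_zero, Fin.cons_succ]
    -- With the first index frozen at `l`, the induction hypothesis sums out the others; the slice
    -- condition in position `0` then sums out `l`.
    have h1 : ∀ l, ∑ τ : Fin m → ι, c (Fin.cons l τ) *
        (M (τ' 0) l * ∏ j, M (τ' j.succ) (τ j)) = M (τ' 0) l * c (Fin.cons l (Fin.tail τ')) := by
      intro l
      rw [← sum_prod_mul_eq_of_slices M m (fun τ => c (Fin.cons l τ)) (fun j τ => by
        have := hc j.succ (Fin.cons l τ)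
        simpa [← Fin.cons_update] using this) (Fin.tail τ'), Finset.mul_sum]
      refine Finset.sum_congr rfl fun τ _ => ?_
      simp only [Fin.tail]
      ring
    rw [Finset.sum_congr rfl fun l _ => h1 l, ← hc 0 τ']
    refine Finset.sum_congr rfl fun l _ => ?_
    rw [← Fin.cons_self_tail τ', Fin.update_cons_zero]
    simp

/-- The matrix with entries `g l` at `a i` fixes every vector of values of a form of degree `t`,
hence every slice of `c`, and so its tensor power fixes `c`. -/
theorem evalAll_tensorSum {g : Fin n → MvPolynomial (Fin (r + 2)) K}
    (hg : ∀ φ : MvPolynomial (Fin (r + 2)) K, φ.IsHomogeneous t →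
        φ - ∑ i, C (eval (a i) φ) * g i ∈ Phi a t)
    {c : (Fin (r + 1) → Fin n) → K}
    (hc : ∀ j τ, ∃ φ : MvPolynomial (Fin (r + 2)) K, φ.IsHomogeneous t ∧
      ∀ l, c (Function.update τ j l) = eval (a l) φ) (τ : Fin (r + 1) → Fin n) :
    evalAll (fun j => a (τ j)) (tensorSum g c) = c τ := by
  rw [← sum_prod_mul_eq_of_slices (fun i l => eval (a i) (g l)) (r + 1) c ?_ τ]
  · simp only [evalAll, tensorSum, map_sum, map_mul, eval_C, map_prod, eval_rename]
    rfl
  · intro j τ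
    obtain ⟨φ, hφ, h⟩ := hc j τ
    have h1 := (mem_Phi.1 (hg φ hφ)).2 (τ j)
    rw [map_sub, sub_eq_zero, map_sum] at h1
    have h2 := h (τ j)
    rw [Function.update_eq_self] at h2
    rw [h2, h1]
    refine Finset.sum_congr rfl fun l _ => ?_
    rw [h l, map_mul, eval_C, mul_comm]

end Interpolation

/-! ### Signs of sequences -/

section Signs

variable {m n : ℕ}

theorem orderSign_comp_perm {τ : Fin m → Fin n} (hτ : Function.Injective τ)
    (σ : Equiv.Perm (Fin m)) :
    orderSign (τ ∘ σ) = Equiv.Perm.sign σ * orderSign τ := by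
  have h : Tuple.sort τ = σ * Tuple.sort (τ ∘ σ) := by
    refine Equiv.ext fun i => hτ ?_
    have := congrFun (Tuple.comp_perm_comp_sort_eq_comp_sort (f := τ) (σ := σ)) i
    exact this.symm
  rw [orderSign, orderSign, h, map_mul, ← mul_assoc, Int.units_mul_self, one_mul]

theorem orderSign_of_monotone {τ : Fin m → Fin n} (hτ : Monotone τ) : orderSign τ = 1 := by
  rw [orderSign, Tuple.sort_eq_refl_iff_monotone.2 hτ]
  exact Equiv.Perm.sign_refl

/-- The sign of the sequence consisting of `S` in increasing order followed by `x`. -/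
noncomputable def snocSign (S : Finset (Fin n)) (x : Fin n) : ℤˣ :=
  orderSign (Fin.snoc (α := fun _ => Fin n) (S.orderEmbOfFin rfl) x)

theorem snocSign_eq {S : Finset (Fin n)} (hS : S.card = m) (x : Fin n) :
    snocSign S x = orderSign (Fin.snoc (α := fun _ => Fin n) (S.orderEmbOfFin hS) x) := by
  subst hS; rfl

/-- Sorting is done in two stages: the first `m` entries are sorted with `x` left at the end, and
then `x` is put in its place. -/
theorem orderSign_snoc {τ : Fin m → Fin n} (hτ : Function.Injective τ) {x : Fin n}
    (hx : ∀ i, τ i ≠ x) :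
    orderSign (Fin.snoc (α := fun _ => Fin n) τ x) =
      orderSign τ * snocSign (Finset.univ.image τ) x := by
  have hcard : (Finset.univ.image τ).card = m := by
    rw [Finset.card_image_of_injective _ hτ, Finset.card_fin]
  set e := (Finset.univ.image τ).orderEmbOfFin hcard with he
  have hsort : e = τ ∘ Tuple.sort τ := by
    symm
    refine Finset.orderEmbOfFin_unique hcard (fun i => by simp) ?_
    exact (Tuple.monotone_sort τ).strictMono_of_injective
      (hτ.comp (Tuple.sort τ).injective)
  obtain ⟨ρ, hρ, hρs⟩ : ∃ ρ : Equiv.Perm (Fin (m + 1)), (Fin.snoc (α := fun _ => Fin n) e x =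
      Fin.snoc (α := fun _ => Fin n) τ x ∘ ρ) ∧ Equiv.Perm.sign ρ = orderSign τ := by
    refine ⟨(Tuple.sort τ).viaFintypeEmbedding Fin.castSuccEmb, ?_, ?_⟩
    · funext i
      refine Fin.lastCases ?_ (fun i => ?_) i
      · rw [Function.comp_apply, Equiv.Perm.viaFintypeEmbedding_apply_notMem_range]
        · simp
        · rintro ⟨y, hy⟩
          exact (Fin.castSucc_lt_last y).ne hy
      · have := (Tuple.sort τ).viaFintypeEmbedding_apply_image Fin.castSuccEmb i
        simp only [Fin.coe_castSuccEmb] at this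
        rw [Function.comp_apply, this, Fin.snoc_castSucc, Fin.snoc_castSucc, hsort]
        rfl
    · rw [Equiv.Perm.viaFintypeEmbedding_sign, orderSign]
  have hinj : Function.Injective (Fin.snoc (α := fun _ => Fin n) τ x) :=
    Fin.snoc_injective_of_injective hτ (by rintro ⟨i, hi⟩; exact hx i hi)
  rw [snocSign_eq hcard, ← he, hρ, orderSign_comp_perm hinj, hρs, ← mul_assoc,
    Int.units_mul_self, one_mul]

theorem snocSign_of_forall_lt {S : Finset (Fin n)} {x : Fin n} (h : ∀ i ∈ S, i < x) :
    snocSign S x = 1 := by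
  refine orderSign_of_monotone ?_
  intro i j
  refine Fin.lastCases ?_ (fun i => ?_) i <;> refine Fin.lastCases ?_ (fun j => ?_) j
  · simp
  · intro hij
    exact absurd (Fin.castSucc_lt_last j) hij.not_gt
  · intro _
    simpa using (h _ (S.orderEmbOfFin_mem rfl i)).le
  · intro hij
    simpa using hij

/-- Exchanging the last two entries of a sequence changes its sign. -/
theorem snocSign_swap {D : Finset (Fin n)} {x y : Fin n} (hx : x ∉ D) (hy : y ∉ D) (hxy : x ≠ y) :
    snocSign D x * snocSign (insert x D) y = -(snocSign D y * snocSign (insert y D) x) := by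
  have hδ := (D.orderEmbOfFin rfl).injective
  have himg : Finset.univ.image (D.orderEmbOfFin rfl) = D := by simp
  have hne : ∀ {z}, z ∉ D → ∀ i, D.orderEmbOfFin rfl i ≠ z := by
    rintro z hz i rfl
    exact hz (D.orderEmbOfFin_mem rfl i)
  have hinj : ∀ {z}, z ∉ D →
      Function.Injective (Fin.snoc (α := fun _ => Fin n) (D.orderEmbOfFin rfl) z) := fun hz =>
    Fin.snoc_injective_of_injective hδ (by rintro ⟨i, hi⟩; exact hne hz i hi)
  have himg2 : ∀ z, Finset.univ.image (Fin.snoc (α := fun _ => Fin n) (D.orderEmbOfFin rfl) z) =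
      insert z D := by
    intro z
    ext w
    simp only [Finset.mem_image, Finset.mem_univ, true_and, Finset.mem_insert]
    constructor
    · rintro ⟨i, rfl⟩
      refine Fin.lastCases ?_ (fun i => ?_) i
      · simp
      · simp
    · rintro (rfl | hw)
      · exact ⟨Fin.last _, by simp⟩
      · rw [← himg] at hw
        obtain ⟨i, -, rfl⟩ := Finset.mem_image.1 hw
        exact ⟨i.castSucc, by simp⟩
  have hne2 : ∀ {z w}, w ∉ D → w ≠ z →
      ∀ i, Fin.snoc (α := fun _ => Fin n) (D.orderEmbOfFin rfl) z i ≠ w := by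
    intro z w hw hwz i
    refine Fin.lastCases ?_ (fun i => ?_) i
    · simpa using hwz.symm
    · simpa using hne hw i
  -- Each side of the claim is thus the sign of `D` followed by two points, and the two sequences
  -- differ by a transposition.
  have hP : ∀ {z w}, z ∉ D → w ∉ D → w ≠ z →
      orderSign (Fin.snoc (α := fun _ => Fin n)
        (Fin.snoc (α := fun _ => Fin n) (D.orderEmbOfFin rfl) z) w) =
      snocSign D z * snocSign (insert z D) w := by
    intro z w hz hw hwz
    rw [orderSign_snoc (hinj hz) (hne2 hw hwz), himg2]
    rfl
  rw [← hP hx hy hxy.symm, ← hP hy hx hxy]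
  have hinj2 : Function.Injective (Fin.snoc (α := fun _ => Fin n)
        (Fin.snoc (α := fun _ => Fin n) (D.orderEmbOfFin rfl) y) x) :=
    Fin.snoc_injective_of_injective (hinj hy) (by rintro ⟨i, hi⟩; exact hne2 hx hxy i hi)
  have hlt : (Fin.castSucc (Fin.last D.card)) ≠ Fin.last (D.card + 1) :=
    (Fin.castSucc_lt_last _).ne
  have hcomp : Fin.snoc (α := fun _ => Fin n)
        (Fin.snoc (α := fun _ => Fin n) (D.orderEmbOfFin rfl) x) y =
      Fin.snoc (α := fun _ => Fin n)
        (Fin.snoc (α := fun _ => Fin n) (D.orderEmbOfFin rfl) y) x ∘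
        Equiv.swap (Fin.castSucc (Fin.last D.card)) (Fin.last (D.card + 1)) := by
    funext i
    refine Fin.lastCases ?_ (fun i => ?_) i
    · simp
    · refine Fin.lastCases ?_ (fun i => ?_) i
      · simp
      · rw [Function.comp_apply, Equiv.swap_apply_of_ne_of_ne]
        · simp
        · exact fun h => (Fin.castSucc_lt_last i).ne (Fin.castSucc_injective _ h)
        · exact (Fin.castSucc_lt_last _).ne
  rw [hcomp, orderSign_comp_perm hinj2, Equiv.Perm.sign_swap hlt, neg_one_mul]

end Signs

/-! ### From cyclic relations and single exchanges to independence of the point -/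

section Exchange

variable {K : Type*} [Field K] {α : Type*} [DecidableEq α] {r : ℕ}

/-- A function `w` on pairs `x ∈ C` with `|C| = r + 1` that satisfies the cyclic relation of the
lemma of tangents, and agrees along one exchange towards `E` from every `r`-set, does not depend
on `x`. -/
theorem eq_of_cyclic_of_exchange {E : Finset α} (hE : E.card = r) {w : Finset α → α → K}
    (hne : ∀ C x, C.card = r + 1 → x ∈ C → w C x ≠ 0)
    (hcyc : ∀ (T : Finset α) (x y z : α), T.card + 1 = r → x ∉ T → y ∉ T → z ∉ T →
      x ≠ y → y ≠ z → x ≠ z →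
      w (insert x (insert y T)) y * w (insert y (insert z T)) z * w (insert x (insert z T)) x =
      w (insert x (insert y T)) x * w (insert y (insert z T)) y * w (insert x (insert z T)) z)
    (hpar : ∀ S : Finset α, S.card = r → S ≠ E → ∃ e ∈ E, ∃ b ∉ E, e ∉ S ∧ b ∈ S ∧
      w (insert e S) e = w (insert e S) b)
    {C : Finset α} (hC : C.card = r + 1) {x y : α} (hx : x ∈ C) (hy : y ∈ C) :
    w C x = w C y := by
  -- The induction is on the level of a pair `(C, x)`: the number of points of `C.erase x` outside
  -- `E`.
  suffices H : ∀ m : ℕ, ∀ C : Finset α, C.card = r + 1 → ∀ x ∈ C, ∀ y ∈ C,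
      ((C.erase x) \ E).card ≤ m → ((C.erase y) \ E).card ≤ m → w C x = w C y from
    H _ C hC x hx y hy (le_max_left _ _) (le_max_right _ _)
  clear hx hy hC x y C
  have level_mem : ∀ {C : Finset α} {x : α}, x ∈ E → (C.erase x \ E).card = (C \ E).card := by
    intro C x hx
    congr 1
    ext z
    simp only [Finset.mem_sdiff, Finset.mem_erase]
    exact ⟨fun h => ⟨h.1.2, h.2⟩, fun h => ⟨⟨fun e => h.2 (e ▸ hx), h.1⟩, h.2⟩⟩
  have level_notMem : ∀ {C : Finset α} {x : α}, x ∈ C → x ∉ E →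
      (C.erase x \ E).card + 1 = (C \ E).card := by
    intro C x hxC hx
    have : C.erase x \ E = (C \ E).erase x := by
      ext z
      simp only [Finset.mem_sdiff, Finset.mem_erase]
      tauto
    rw [this, Finset.card_erase_add_one (Finset.mem_sdiff.2 ⟨hxC, hx⟩)]
  -- Since `w` does not vanish, two of the three equalities around a triangle imply the third.
  have triangle : ∀ (T : Finset α) (x y z : α), T.card + 1 = r → x ∉ T → y ∉ T → z ∉ T →
      x ≠ y → y ≠ z → x ≠ z →
      w (insert x (insert y T)) x = w (insert x (insert y T)) y →
      w (insert y (insert z T)) y = w (insert y (insert z T)) z →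
      w (insert x (insert z T)) x = w (insert x (insert z T)) z := by
    intro T x y z hT hx hy hz hxy hyz hxz h1 h2
    have h := hcyc T x y z hT hx hy hz hxy hyz hxz
    rw [h1, h2] at h
    have c1 : (insert x (insert y T)).card = r + 1 := by
      rw [Finset.card_insert_of_notMem (by simp [hxy, hx]), Finset.card_insert_of_notMem hy, hT]
    have c2 : (insert y (insert z T)).card = r + 1 := by
      rw [Finset.card_insert_of_notMem (by simp [hyz, hy]), Finset.card_insert_of_notMem hz, hT]
    exact mul_left_cancel₀ (mul_ne_zero (hne _ y c1 (by simp)) (hne _ z c2 (by simp))) h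
  intro m
  induction m with
  | zero =>
    intro C hC x hx y hy h1 h2
    -- At level `0` the remaining `r` points are exactly `E`, which forces `x = y`.
    have key : ∀ z ∈ C, (C.erase z \ E).card ≤ 0 → C.erase z = E := by
      intro z hz h
      refine Finset.eq_of_subset_of_card_le
        (Finset.sdiff_eq_empty_iff_subset.1 (Finset.card_eq_zero.1 (Nat.le_zero.1 h))) ?_
      rw [Finset.card_erase_of_mem hz, hC, hE]
      simp
    have : C.erase x = C.erase y := (key x hx h1).trans (key y hy h2).symm
    have hxy : x = y := by
      by_contra hxy
      exact Finset.notMem_erase x C (this ▸ Finset.mem_erase.2 ⟨hxy, hx⟩)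
    rw [hxy]
  | succ m ih =>
    -- The exchange `e, b` supplied for `S` is spread to every pair: `b` is replaced by `y` at level
    -- `m`, and `e` by `x` through a triangle whose third side `x, e` also has level `m`.
    have down : ∀ (S : Finset α), S.card = r → (S \ E).card = m + 1 → ∀ x ∈ E, x ∉ S →
        ∀ y ∈ S, y ∉ E → w (insert x S) x = w (insert x S) y := by
      intro S hS hSE x hxE hxS y hyS hyE
      obtain ⟨e, heE, b, hbE, heS, hbS, heb⟩ := hpar S hS (by
        rintro rfl
        simp at hSE)
      have lev : ∀ (e : α), e ∈ E → ∀ b ∈ S, b ∉ E → ((insert e S).erase b \ E).card = m := by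
        intro e he b hb hbE
        have h1 := level_notMem (C := insert e S) (x := b) (Finset.mem_insert_of_mem hb) hbE
        rw [Finset.insert_sdiff_of_mem _ he, hSE] at h1
        omega
      have hcS : ∀ e ∉ S, (insert e S).card = r + 1 := fun e he => by
        rw [Finset.card_insert_of_notMem he, hS]
      have h1 : w (insert e S) e = w (insert e S) y := heb.trans
        (ih _ (hcS e heS) b (Finset.mem_insert_of_mem hbS) y (Finset.mem_insert_of_mem hyS)
          (lev e heE b hbS hbE).le (lev e heE y hyS hyE).le)
      by_cases hex : e = x
      · rw [← hex]
        exact h1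
      obtain ⟨T, hyT, rfl⟩ : ∃ T, y ∉ T ∧ insert y T = S :=
        ⟨S.erase y, Finset.notMem_erase _ _, Finset.insert_erase hyS⟩
      have heT : e ∉ T := fun h => heS (Finset.mem_insert_of_mem h)
      have hxT : x ∉ T := fun h => hxS (Finset.mem_insert_of_mem h)
      have hxy : x ≠ y := fun h => hyE (h ▸ hxE)
      have hey : e ≠ y := fun h => hyE (h ▸ heE)
      rw [Finset.card_insert_of_notMem hyT] at hS
      have lT : (T \ E).card = m := by
        have := level_notMem (C := insert y T) (x := y) (by simp) hyE
        rw [hSE, Finset.erase_insert hyT] at this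
        omega
      have lT' : ∀ z ∈ E, (insert z T \ E).card = m := fun z hz => by
        rw [Finset.insert_sdiff_of_mem _ hz, lT]
      refine triangle T x e y hS hxT heT hyT (Ne.symm hex) hey hxy ?_ h1
      refine ih _ ?_ _ (by simp) _ (by simp) ?_ ?_
      · rw [Finset.card_insert_of_notMem (by simp [Ne.symm hex, hxT]),
          Finset.card_insert_of_notMem heT, hS]
      · rw [Finset.erase_insert (by simp [Ne.symm hex, hxT]), lT' e heE]
      · rw [Finset.insert_comm, Finset.erase_insert (by simp [hex, heT]), lT' x hxE]
    have down' : ∀ C : Finset α, C.card = r + 1 → ∀ x ∈ C, x ∈ E → ∀ y ∈ C, y ∉ E →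
        (C.erase x \ E).card ≤ m + 1 → w C x = w C y := by
      intro C hC x hx hxE y hy hyE h
      have h1 : (C.erase x).card = r := by rw [Finset.card_erase_of_mem hx, hC]; rfl
      have h2 := level_mem (C := C) hxE
      have h3 := level_notMem hy hyE
      rcases h.lt_or_eq with h | h
      · exact ih C hC x hx y hy (by omega) (by omega)
      · have := down _ h1 h x hxE (Finset.notMem_erase _ _) y
          (Finset.mem_erase.2 ⟨fun e => hyE (e ▸ hxE), hy⟩) hyE
        rwa [Finset.insert_erase hx] at this
    intro C hC x hx y hy h1 h2
    by_cases hxy : x = y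
    · rw [hxy]
    by_cases hxE : x ∈ E <;> by_cases hyE : y ∈ E
    -- Two points of `E` are compared through a point of `C` outside `E`, which exists because `C`
    -- is larger than `E`.
    · obtain ⟨z, hzC, hzE⟩ : ∃ z ∈ C, z ∉ E := by
        by_contra! h
        have := Finset.card_le_card (show C ⊆ E from h)
        omega
      exact (down' C hC x hx hxE z hzC hzE h1).trans (down' C hC y hy hyE z hzC hzE h2).symm
    · exact down' C hC x hx hxE y hy hyE h1
    · exact (down' C hC y hy hyE x hx hxE h2).symm
    · have hx3 := level_notMem hx hxE
      have hy3 := level_notMem hy hyE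
      rcases h1.lt_or_eq with h | h
      · exact ih C hC x hx y hy (by omega) (by omega)
      obtain ⟨T, hxT, hyT, rfl⟩ : ∃ T, x ∉ T ∧ y ∉ T ∧ insert x (insert y T) = C := by
        refine ⟨(C.erase x).erase y, by simp, by simp, ?_⟩
        rw [Finset.insert_erase (Finset.mem_erase.2 ⟨Ne.symm hxy, hy⟩), Finset.insert_erase hx]
      rw [Finset.card_insert_of_notMem (by simp [hxy, hxT]),
        Finset.card_insert_of_notMem hyT] at hC
      -- Two points outside `E` are compared through a triangle whose third vertex `e` lies in `E`,
      -- so that the other two sides are mixed pairs.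
      obtain ⟨e, heE, heT⟩ : ∃ e ∈ E, e ∉ T := by
        by_contra! h
        have := Finset.card_le_card (show E ⊆ T from h)
        omega
      have hex : e ≠ x := fun h => hxE (h ▸ heE)
      have hey : e ≠ y := fun h => hyE (h ▸ heE)
      rw [Finset.erase_insert (by simp [hxy, hxT])] at h h1
      rw [Finset.insert_comm, Finset.erase_insert (by simp [Ne.symm hxy, hyT])] at h2
      have step : ∀ z, z ∉ T → z ∉ E → (insert z T \ E).card ≤ m + 1 →
          w (insert e (insert z T)) e = w (insert e (insert z T)) z := by
        intro z hz hzE hl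
        have hez : e ≠ z := fun h => hzE (h ▸ heE)
        refine down' _ ?_ _ (by simp) heE _ (by simp) hzE ?_
        · rw [Finset.card_insert_of_notMem (by simp [hez, heT]),
            Finset.card_insert_of_notMem hz]
          omega
        · rwa [Finset.erase_insert (by simp [hez, heT])]
      refine triangle T x e y (by omega) hxT heT hyT hex.symm hey hxy ?_ (step y hyT hyE h1)
      rw [Finset.insert_comm]
      exact (step x hxT hxE h2).symm

end Exchange

/-! ### Linear forms as polynomials and as functionals -/

section LinearForms

variable {K : Type*} [Field K] {ι : Type*}

theorem exists_dual_eq_eval {α : MvPolynomial ι K} (hα : α.IsHomogeneous 1) :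
    ∃ m : Module.Dual K (ι → K), ∀ x, eval x α = m x := by
  have h : α ∈ homogeneousSubmodule ι K 1 := hα
  rw [homogeneousSubmodule_one_eq_span_X] at h
  induction h using Submodule.span_induction with
  | mem _ h =>
    obtain ⟨i, rfl⟩ := h
    exact ⟨LinearMap.proj i, fun x => by simp⟩
  | zero => exact ⟨0, fun x => by simp⟩
  | add p q hp hq h1 h2 =>
    obtain ⟨m1, h1⟩ := h1 ((mem_homogeneousSubmodule _ _).1
      (by rw [homogeneousSubmodule_one_eq_span_X]; exact hp))
    obtain ⟨m2, h2⟩ := h2 ((mem_homogeneousSubmodule _ _).1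
      (by rw [homogeneousSubmodule_one_eq_span_X]; exact hq))
    exact ⟨m1 + m2, fun x => by simp [h1, h2]⟩
  | smul c p hp h1 =>
    obtain ⟨m1, h1⟩ := h1 ((mem_homogeneousSubmodule _ _).1
      (by rw [homogeneousSubmodule_one_eq_span_X]; exact hp))
    exact ⟨c • m1, fun x => by simp [h1]⟩

theorem exists_linear_form_eval_eq [Fintype ι] [DecidableEq ι] (m : Module.Dual K (ι → K)) :
    ∃ α : MvPolynomial ι K, α.IsHomogeneous 1 ∧ ∀ x, eval x α = m x := by
  refine ⟨∑ i, C (m (Pi.single i 1)) * X i,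
    IsHomogeneous.sum _ _ _ fun i _ => isHomogeneous_C_mul_X _ i, fun x => ?_⟩
  conv_rhs => rw [pi_eq_sum_univ' x, map_sum]
  simp only [map_sum, map_mul, eval_C, eval_X, map_smul, smul_eq_mul]
  exact Finset.sum_congr rfl fun i _ => mul_comm _ _

end LinearForms

/-! ### Hyperplanes and vectors in general position -/

section Hyperplanes

variable {K : Type*} [Field K] {r n : ℕ} {a : Fin n → Fin (r + 2) → K}

theorem exists_dual_ker_eq {H : Submodule K (Fin (r + 2) → K)}
    (hH : Module.finrank K H = r + 1) :
    ∃ m : Module.Dual K (Fin (r + 2) → K), m ≠ 0 ∧ LinearMap.ker m = H := by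
  have hlt : H < ⊤ := by
    refine lt_top_iff_ne_top.2 ?_
    rintro rfl
    simp at hH
  obtain ⟨m, hm, hle⟩ := Submodule.exists_le_ker_of_lt_top H hlt
  have h1 := Module.Dual.finrank_ker_add_one_of_ne_zero hm
  rw [Module.finrank_fin_fun] at h1
  exact ⟨m, hm, (Submodule.eq_of_le_of_finrank_eq hle (by omega)).symm⟩

theorem finrank_ker_dual {m : Module.Dual K (Fin (r + 2) → K)} (hm : m ≠ 0) :
    Module.finrank K (LinearMap.ker m) = r + 1 := by
  have h1 := Module.Dual.finrank_ker_add_one_of_ne_zero hm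
  rw [Module.finrank_fin_fun] at h1
  omega

/-- Vectors any `r + 2` of which are linearly independent; this also constrains shorter lists. -/
def GeneralPosition (a : Fin n → Fin (r + 2) → K) : Prop :=
  ∀ T : Finset (Fin n), T.card ≤ r + 2 → LinearIndependent K fun i : T => a i

/-- If there are at least `r + 2` points, `T` is enlarged to that size; vectors that fail to span
would put `r + 2` arc points in a hyperplane. For fewer points the arc condition is empty and
`hsmall` takes its place. -/
theorem IsArc.generalPosition {A : Set (ℙ K (Fin (r + 2) → K))} (hA : IsArc A)
    (p : Fin n ≃ A) (ha : ∀ i, a i ≠ 0) (hp : ∀ i, Projectivization.mk K (a i) (ha i) = p i)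
    (hsmall : n < r + 2 → LinearIndependent K a) : GeneralPosition a := by
  intro T hT
  rcases lt_or_ge n (r + 2) with hn | hn
  · exact (hsmall hn).comp _ Subtype.val_injective
  obtain ⟨T', hTT', hT'⟩ := Finset.exists_superset_card_eq hT (by simpa using hn)
  suffices h : LinearIndependent K fun i : T' => a i from
    h.comp (fun i : T => (⟨i, hTT' i.2⟩ : T'))
      (fun i j hij => Subtype.ext (congrArg (fun k : T' => (k : Fin n)) hij))
  refine linearIndependent_of_top_le_span_of_card_eq_finrank ?_ (by simp [hT'])
  by_contra hspan
  obtain ⟨m, hm, hle⟩ := Submodule.exists_le_ker_of_lt_top _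
    (lt_top_iff_ne_top.2 fun h => hspan (top_le_iff.2 h))
  classical
  refine hA (T'.image fun i => (p i : ℙ K (Fin (r + 2) → K))) ?_ ?_ _ (finrank_ker_dual hm) ?_
  · intro P hP
    obtain ⟨i, -, rfl⟩ := Finset.mem_image.1 (Finset.mem_coe.1 hP)
    exact (p i).2
  · rw [Finset.card_image_of_injective T' (f := fun i => (p i : ℙ K (Fin (r + 2) → K)))
      (Subtype.val_injective.comp p.injective), hT']
  · intro P hP
    obtain ⟨i, hi, rfl⟩ := Finset.mem_image.1 hP
    rw [← hp i, Projectivization.submodule_mk, Submodule.span_singleton_le_iff_mem]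
    exact hle (Submodule.subset_span ⟨⟨i, hi⟩, rfl⟩)

namespace GeneralPosition

theorem card_le (hli : GeneralPosition a) {H : Submodule K (Fin (r + 2) → K)}
    (hH : Module.finrank K H = r + 1) {T : Finset (Fin n)} (hT : ∀ i ∈ T, a i ∈ H) :
    T.card ≤ r + 1 := by
  by_contra! hcard
  obtain ⟨T', hsub, hT'⟩ := Finset.exists_subset_card_eq (n := r + 2) hcard
  have h1 : LinearIndependent K (fun i : T' => (⟨a i, hT i (hsub i.2)⟩ : H)) :=
    LinearIndependent.of_comp H.subtype (hli T' hT'.le)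
  have := h1.fintype_card_le_finrank
  rw [Fintype.card_coe, hT', hH] at this
  omega

theorem dual_ne_zero (hli : GeneralPosition a) {m : Module.Dual K (Fin (r + 2) → K)} (hm : m ≠ 0)
    {U : Finset (Fin n)} (hU : U.card = r + 1) (h0 : ∀ i ∈ U, m (a i) = 0) {p : Fin n}
    (hp : p ∉ U) : m (a p) ≠ 0 := by
  intro h
  have := hli.card_le (finrank_ker_dual hm) (T := insert p U) (by
    intro i hi
    rcases Finset.mem_insert.1 hi with rfl | hi
    · exact h
    · exact h0 i hi)
  rw [Finset.card_insert_of_notMem hp] at this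
  omega

theorem exists_dual (hli : GeneralPosition a) {T : Finset (Fin n)} (hT : T.card ≤ r + 2)
    (v : Fin n → K) : ∃ m : Module.Dual K (Fin (r + 2) → K), ∀ i ∈ T, m (a i) = v i := by
  have h := hli T hT
  obtain ⟨m, hm⟩ := LinearMap.exists_extend ((Module.Basis.span h).constr K fun i : T => v i)
  refine ⟨m, fun i hi => ?_⟩
  have h1 := LinearMap.congr_fun hm (Module.Basis.span h ⟨i, hi⟩)
  rw [Module.Basis.constr_basis] at h1
  rw [← h1, LinearMap.comp_apply, Submodule.subtype_apply, Module.Basis.span_apply]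

theorem finrank_span (hli : GeneralPosition a) {T : Finset (Fin n)} (hT : T.card ≤ r + 2) :
    Module.finrank K (Submodule.span K (a '' T)) = T.card := by
  have := finrank_span_eq_card (hli T hT)
  rw [Fintype.card_coe] at this
  rw [Set.image_eq_range]
  exact this

end GeneralPosition

end Hyperplanes

/-! ### Counting tangent hyperplanes; tangent forms -/

section Counting

variable {K : Type*} [Field K] [Finite K] {r n : ℕ} {a : Fin n → Fin (r + 2) → K}

theorem mem_tangentHyperplanes {S : Finset (Fin n)} {H : Submodule K (Fin (r + 2) → K)} :
    H ∈ tangentHyperplanes a S ↔ Module.finrank K H = r + 1 ∧ ∀ i, a i ∈ H ↔ i ∈ S := by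
  simp [tangentHyperplanes]

/-- These hyperplanes correspond to the one-dimensional subspaces of the two-dimensional quotient by
`W`, the points of a projective line. -/
theorem card_hyperplanes_ge {W : Submodule K (Fin (r + 2) → K)} (hW : Module.finrank K W = r) :
    Nat.card {H : Submodule K (Fin (r + 2) → K) // Module.finrank K H = r + 1 ∧ W ≤ H} =
      Nat.card K + 1 := by
  have hq : Module.finrank K ((Fin (r + 2) → K) ⧸ W) = 2 := by
    have := W.finrank_quotient_add_finrank
    rw [Module.finrank_fin_fun] at this
    omega
  rw [← Projectivization.card_of_finrank_two K _ hq,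
    Nat.card_congr (Projectivization.equivSubmodule K _)]
  have hfr : ∀ H' : Submodule K ((Fin (r + 2) → K) ⧸ W),
      Module.finrank K (H'.comap W.mkQ) = Module.finrank K H' + r := by
    intro H'
    have h1 := (H'.mkQ ∘ₗ W.mkQ).finrank_range_add_finrank_ker
    rw [LinearMap.range_comp, Submodule.range_mkQ, Submodule.map_top, Submodule.range_mkQ, finrank_top,
      LinearMap.ker_comp, Submodule.ker_mkQ, Module.finrank_fin_fun] at h1
    have h2 := H'.finrank_quotient_add_finrank
    omega
  refine Nat.card_congr (Equiv.symm ?_)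
  refine (((Submodule.comapMkQRelIso W).toEquiv.subtypeEquiv
    (q := fun H : Set.Ici W => Module.finrank K H.1 = r + 1) fun H' => ?_)).trans ?_
  · have := hfr H'
    change _ ↔ Module.finrank K (H'.comap W.mkQ) = r + 1
    omega
  · exact (Equiv.subtypeSubtypeEquivSubtypeInter (fun H => W ≤ H)
      (fun H : Submodule K (Fin (r + 2) → K) => Module.finrank K H = r + 1)).trans
      (Equiv.subtypeEquivRight fun H => and_comm)

namespace GeneralPosition

/-- Of the `q + 1` hyperplanes through `S`, each of the `n - r` other arc points spans a different
one with `S`; the rest are tangent. For an arc of size `q + k - 1 - t` this leaves `t`. -/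
theorem card_tangentHyperplanes (hli : GeneralPosition a) {S : Finset (Fin n)}
    (hS : S.card = r) : (tangentHyperplanes a S).card + n = Nat.card K + (r + 1) := by
  classical
  set W := Submodule.span K (a '' S) with hWdef
  have hW : Module.finrank K W = r := by rw [hWdef, hli.finrank_span (by omega), hS]
  have hWle : ∀ {H : Submodule K (Fin (r + 2) → K)}, W ≤ H ↔ ∀ i ∈ S, a i ∈ H := by
    intro H
    rw [hWdef, Submodule.span_le, Set.image_subset_iff]
    rfl
  set h : Fin n → Submodule K (Fin (r + 2) → K) :=
    fun i => Submodule.span K (a '' (insert i S : Finset (Fin n))) with hh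
  have hfin : ∀ i ∉ S, Module.finrank K (h i) = r + 1 := by
    intro i hi
    have hc : (insert i S).card = r + 1 := by rw [Finset.card_insert_of_notMem hi, hS]
    rw [hh]
    simp only
    rw [hli.finrank_span (by omega), hc]
  have hmem : ∀ i j, j ∈ insert i S → a j ∈ h i := fun i j hj =>
    Submodule.subset_span ⟨j, hj, rfl⟩
  have hmem' : ∀ i ∉ S, ∀ j, a j ∈ h i → j ∈ insert i S := by
    intro i hi j hj
    by_contra hc
    have := hli.card_le (hfin i hi) (T := insert j (insert i S)) (by
      intro k hk
      rcases Finset.mem_insert.1 hk with rfl | hk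
      · exact hj
      · exact hmem i k hk)
    rw [Finset.card_insert_of_notMem hc, Finset.card_insert_of_notMem hi, hS] at this
    omega
  have hunion : (Set.toFinite {H : Submodule K (Fin (r + 2) → K) |
      Module.finrank K H = r + 1 ∧ W ≤ H}).toFinset = tangentHyperplanes a S ∪ Sᶜ.image h := by
    ext H
    simp only [Set.Finite.mem_toFinset, Set.mem_ofPred_eq, Finset.mem_union,
      mem_tangentHyperplanes, Finset.mem_image, Finset.mem_compl, hWle]
    constructor
    · rintro ⟨hH, hSH⟩
      by_cases hc : ∃ i ∉ S, a i ∈ H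
      · obtain ⟨i, hi, hiH⟩ := hc
        refine Or.inr ⟨i, hi, ?_⟩
        refine Submodule.eq_of_le_of_finrank_eq ?_ (by rw [hH, hfin i hi])
        rw [hh]
        simp only
        rw [Submodule.span_le]
        rintro _ ⟨j, hj, rfl⟩
        rcases Finset.mem_insert.1 (Finset.mem_coe.1 hj) with rfl | hj
        · exact hiH
        · exact hSH j hj
      · push Not at hc
        exact Or.inl ⟨hH, fun i => ⟨fun hi => by_contra fun hS => hc i hS hi, hSH i⟩⟩
    · rintro (⟨hH, hi⟩ | ⟨i, hi, rfl⟩)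
      · exact ⟨hH, fun i => (hi i).2⟩
      · exact ⟨hfin i hi, fun j hj => hmem i j (Finset.mem_insert_of_mem hj)⟩
  have hdisj : Disjoint (tangentHyperplanes a S) (Sᶜ.image h) := by
    rw [Finset.disjoint_left]
    intro H hH hH'
    obtain ⟨i, hi, rfl⟩ := Finset.mem_image.1 hH'
    exact Finset.mem_compl.1 hi (((mem_tangentHyperplanes.1 hH).2 i).1 (hmem i i (by simp)))
  have hinj : Set.InjOn h (Sᶜ : Finset (Fin n)) := by
    intro i hi j hj hij
    simp only [Finset.coe_compl, Set.mem_compl_iff, Finset.mem_coe] at hi hj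
    have := hmem' j hj i (hij ▸ hmem i i (by simp))
    exact (Finset.mem_insert.1 this).resolve_right hi
  have hcard := card_hyperplanes_ge hW
  rw [← Set.coe_ofPred, Nat.card_coe_set_eq, Set.ncard_eq_toFinset_card _ (Set.toFinite _), hunion,
    Finset.card_union_of_disjoint hdisj, Finset.card_image_of_injOn hinj, Finset.card_compl,
    Fintype.card_fin, hS] at hcard
  have := S.card_le_univ
  rw [Fintype.card_fin] at this
  omega

end GeneralPosition

theorem exists_isTangentForm (a : Fin n → Fin (r + 2) → K) (S : Finset (Fin n)) :
    ∃ f, IsTangentForm a S f := by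
  have h : ∀ H : Submodule K (Fin (r + 2) → K), ∃ α : MvPolynomial (Fin (r + 2)) K,
      H ∈ tangentHyperplanes a S → α.IsHomogeneous 1 ∧ ∀ x, eval x α = 0 ↔ x ∈ H := by
    intro H
    by_cases hH : H ∈ tangentHyperplanes a S
    · obtain ⟨m, -, hm⟩ := exists_dual_ker_eq (mem_tangentHyperplanes.1 hH).1
      obtain ⟨α, hα, hα'⟩ := exists_linear_form_eval_eq m
      refine ⟨α, fun _ => ⟨hα, fun x => ?_⟩⟩
      rw [hα', ← hm, LinearMap.mem_ker]
    · exact ⟨0, fun h => absurd h hH⟩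
  choose α hα using h
  exact ⟨_, 1, α, one_ne_zero, hα, rfl⟩

namespace IsTangentForm

variable {S : Finset (Fin n)} {f : MvPolynomial (Fin (r + 2)) K}

theorem C_mul (hf : IsTangentForm a S f) {d : K} (hd : d ≠ 0) : IsTangentForm a S (C d * f) := by
  obtain ⟨c, α, hc, hα, rfl⟩ := hf
  exact ⟨d * c, α, mul_ne_zero hd hc, hα, by rw [map_mul, mul_assoc]⟩

theorem isHomogeneous (hf : IsTangentForm a S f) :
    f.IsHomogeneous (tangentHyperplanes a S).card := by
  obtain ⟨c, α, hc, hα, rfl⟩ := hf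
  have := (isHomogeneous_C (Fin (r + 2)) c).mul
    (IsHomogeneous.prod _ α (fun _ => 1) fun H hH => (hα H hH).1)
  simpa using this

theorem eval_ne_zero (hf : IsTangentForm a S f) {i : Fin n} (hi : i ∉ S) : eval (a i) f ≠ 0 := by
  obtain ⟨c, α, hc, hα, rfl⟩ := hf
  rw [map_mul, eval_C, map_prod]
  refine mul_ne_zero hc (Finset.prod_ne_zero_iff.2 fun H hH h0 => hi ?_)
  exact ((mem_tangentHyperplanes.1 hH).2 i).1 (((hα H hH).2 _).1 h0)

/-- Without tangent hyperplanes the form is a nonzero constant; `1 ≤ t` will exclude this. -/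
theorem eval_eq_zero (hf : IsTangentForm a S f) (hne : (tangentHyperplanes a S).Nonempty)
    {i : Fin n} (hi : i ∈ S) : eval (a i) f = 0 := by
  obtain ⟨c, α, hc, hα, rfl⟩ := hf
  obtain ⟨H, hH⟩ := hne
  rw [map_mul, map_prod, Finset.prod_eq_zero hH, mul_zero]
  exact ((hα H hH).2 _).2 (((mem_tangentHyperplanes.1 hH).2 i).2 hi)

end IsTangentForm

end Counting

/-! ### Segre's lemma of tangents -/

section LemmaOfTangents

variable {K : Type*} [Field K] [Fintype K] {r n : ℕ} {a : Fin n → Fin (r + 2) → K}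

theorem prod_filter_ne_zero_eq_neg_one [DecidableEq K] :
    ∏ x ∈ (Finset.univ : Finset K).filter (· ≠ 0), x = -1 := by
  have h := congrArg Units.val (FiniteField.prod_univ_units_id_eq_neg_one (K := K))
  rw [Units.coe_prod, Units.val_neg, Units.val_one] at h
  rw [← h]
  symm
  refine Finset.prod_bij (fun u _ => (u : K)) (by simp) (fun u _ v _ h => Units.ext h) ?_ (by simp)
  intro x hx
  exact ⟨Units.mk0 x (Finset.mem_filter.1 hx).2, by simp, rfl⟩

/-- The quotient of two values of a tangent form, in terms of the coordinates of the points. -/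
theorem IsTangentForm.eval_mul_prod (hli : GeneralPosition a) {S : Finset (Fin n)}
    (hS : S.card = r) {y z : Fin n} (hy : y ∉ S) (hz : z ∉ S) (hyz : y ≠ z)
    {ly lz : Module.Dual K (Fin (r + 2) → K)}
    (hly : ∀ i ∈ S, ly (a i) = 0) (hlz : ∀ i ∈ S, lz (a i) = 0)
    (hyy : ly (a y) = 1) (hyz0 : ly (a z) = 0) (hzz : lz (a z) = 1) (hzy0 : lz (a y) = 0)
    {f : MvPolynomial (Fin (r + 2)) K} (hf : IsTangentForm a S f) :
    eval (a y) f * ∏ p ∈ (insert y (insert z S))ᶜ, (-(lz (a p)) / ly (a p)) =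
      -eval (a z) f := by
  classical
  set N := (insert y (insert z S))ᶜ with hN
  have hNmem : ∀ {p}, p ∈ N ↔ p ≠ y ∧ p ≠ z ∧ p ∉ S := by
    intro p
    simp [hN]
  set ν : Fin n → K := fun p => -(lz (a p)) / ly (a p) with hν
  have hly0 : ly ≠ 0 := by rintro rfl; simp at hyy
  have hlz0 : lz ≠ 0 := by rintro rfl; simp at hzz
  have hlyN : ∀ p ∈ N, ly (a p) ≠ 0 := by
    intro p hp
    obtain ⟨-, hpz, hpS⟩ := hNmem.1 hp
    refine hli.dual_ne_zero hly0 (U := insert z S) (by rw [Finset.card_insert_of_notMem hz, hS])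
      ?_ (by simp [hpz, hpS])
    intro i hi
    rcases Finset.mem_insert.1 hi with rfl | hi
    · exact hyz0
    · exact hly i hi
  have hlzN : ∀ p ∈ N, lz (a p) ≠ 0 := by
    intro p hp
    obtain ⟨hpy, -, hpS⟩ := hNmem.1 hp
    refine hli.dual_ne_zero hlz0 (U := insert y S) (by rw [Finset.card_insert_of_notMem hy, hS])
      ?_ (by simp [hpy, hpS])
    intro i hi
    rcases Finset.mem_insert.1 hi with rfl | hi
    · exact hzy0
    · exact hlz i hi
  -- The pencil of hyperplanes through `S` that avoid `a z`; the member through `a y` is `c = 0`,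
  -- and the one through `a p` is `c = ν p`.
  set h : K → Submodule K (Fin (r + 2) → K) := fun c => LinearMap.ker (c • ly + lz) with hh
  have hmem : ∀ c x, x ∈ h c ↔ c * ly x + lz x = 0 := by
    intro c x
    simp [hh]
  have hfr : ∀ c, Module.finrank K (h c) = r + 1 := by
    intro c
    refine finrank_ker_dual fun h0 => ?_
    have := LinearMap.congr_fun h0 (a z)
    simp [hyz0, hzz] at this
  have hmemS : ∀ c, ∀ i ∈ S, a i ∈ h c := by
    intro c i hi
    rw [hmem, hly i hi, hlz i hi]
    simp
  have hmemN : ∀ c, ∀ p ∈ N, a p ∈ h c ↔ c = ν p := by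
    intro c p hp
    rw [hmem, hν, eq_div_iff (hlyN p hp), eq_neg_iff_add_eq_zero]
  -- A linear form with kernel `h c` therefore takes at `a y` exactly `c` times its value at `a z`.
  have hyh : ∀ c, a y - c • a z ∈ h c := by
    intro c
    rw [hmem]
    simp [hyy, hyz0, hzz, hzy0]
  have hhinj : Function.Injective h := by
    intro c d hcd
    have := hyh c
    rw [hcd, hmem] at this
    simp only [map_sub, map_smul, hyy, hyz0, hzz, hzy0, smul_eq_mul] at this
    linear_combination -this
  set Λ := (Finset.univ : Finset K).filter (fun c => c ≠ 0 ∧ ∀ p ∈ N, c ≠ ν p) with hΛ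
  have htan : tangentHyperplanes a S = Λ.image h := by
    ext H
    rw [mem_tangentHyperplanes, Finset.mem_image]
    constructor
    · rintro ⟨hH, hHS⟩
      obtain ⟨m, hm0, rfl⟩ := exists_dual_ker_eq hH
      have hmz : m (a z) ≠ 0 := fun h0 => hz ((hHS z).1 h0)
      have hmy : m (a y) ≠ 0 := fun h0 => hy ((hHS y).1 h0)
      have hker : h (m (a y) / m (a z)) = LinearMap.ker m := by
        symm
        have hspan : Submodule.span K (a '' (insert y (insert z S) : Finset (Fin n))) = ⊤ := by
          refine Submodule.eq_top_of_finrank_eq ?_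
          have hc : (insert y (insert z S)).card = r + 2 := by
            rw [Finset.card_insert_of_notMem (by simp [hyz, hy]),
              Finset.card_insert_of_notMem hz, hS]
          rw [hli.finrank_span hc.le, hc, Module.finrank_fin_fun]
        have hmeq : m = m (a y) • ly + m (a z) • lz := by
          refine LinearMap.ext_on hspan ?_
          rintro _ ⟨i, hi, rfl⟩
          simp only [Finset.coe_insert, Set.mem_insert_iff, Finset.mem_coe] at hi
          rcases hi with rfl | rfl | hi
          · simp [hyy, hzy0]
          · simp [hyz0, hzz]
          · have : m (a i) = 0 := (hHS i).2 hi
            simp [this, hly i hi, hlz i hi]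
        ext x
        rw [hmem, LinearMap.mem_ker]
        conv_lhs => rw [hmeq]
        simp only [LinearMap.add_apply, LinearMap.smul_apply, smul_eq_mul]
        rw [div_mul_eq_mul_div, div_add' _ _ _ hmz, div_eq_zero_iff, mul_comm (lz x)]
        simp [hmz]
      refine ⟨m (a y) / m (a z), ?_, hker⟩
      rw [hΛ, Finset.mem_filter]
      refine ⟨Finset.mem_univ _, div_ne_zero hmy hmz, fun p hp hpe => ?_⟩
      have := (hmemN _ p hp).2 hpe
      rw [hker] at this
      exact (hNmem.1 hp).2.2 ((hHS p).1 this)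
    · rintro ⟨c, hc, rfl⟩
      rw [hΛ, Finset.mem_filter] at hc
      refine ⟨hfr c, fun i => ⟨fun hi => ?_, hmemS c i⟩⟩
      by_contra hiS
      by_cases hiy : i = y
      · rw [hmem, hiy, hyy, hzy0] at hi
        exact hc.2.1 (by simpa using hi)
      by_cases hiz : i = z
      · rw [hmem, hiz, hyz0, hzz] at hi
        simp at hi
      have hiN := hNmem.2 ⟨hiy, hiz, hiS⟩
      exact hc.2.2 i hiN ((hmemN c i hiN).1 hi)
  have hνinj : Set.InjOn ν N := by
    intro p hp p' hp' hpp
    by_contra hne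
    have hp := Finset.mem_coe.1 hp
    have hp' := Finset.mem_coe.1 hp'
    have := hli.card_le (hfr (ν p)) (T := insert p (insert p' S)) (by
      intro i hi
      simp only [Finset.mem_insert] at hi
      rcases hi with rfl | rfl | hi
      · exact (hmemN _ _ hp).2 rfl
      · exact (hmemN _ _ hp').2 hpp
      · exact hmemS _ i hi)
    rw [Finset.card_insert_of_notMem (by simp [hne, (hNmem.1 hp).2.2]),
      Finset.card_insert_of_notMem (hNmem.1 hp').2.2, hS] at this
    omega
  -- The nonzero parameters are split between tangent hyperplanes and hyperplanes through one
  -- further arc point, and the product of all nonzero field elements is `-1`.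
  have hprod : (∏ c ∈ Λ, c) * ∏ p ∈ N, ν p = -1 := by
    rw [← prod_filter_ne_zero_eq_neg_one (K := K), ← Finset.prod_image (f := fun c => c) hνinj,
      ← Finset.prod_union]
    · refine Finset.prod_congr ?_ fun _ _ => rfl
      ext c
      simp only [hΛ, Finset.mem_union, Finset.mem_filter, Finset.mem_univ, true_and,
        Finset.mem_image]
      constructor
      · rintro (h | ⟨p, hp, rfl⟩)
        · exact h.1
        · exact div_ne_zero (neg_ne_zero.2 (hlzN p hp)) (hlyN p hp)
      · intro hc
        by_cases hex : ∃ p ∈ N, ν p = c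
        · exact Or.inr hex
        · exact Or.inl ⟨hc, fun p hp h => hex ⟨p, hp, h.symm⟩⟩
    · rw [Finset.disjoint_left]
      intro c hc hc'
      obtain ⟨p, hp, rfl⟩ := Finset.mem_image.1 hc'
      exact (Finset.mem_filter.1 hc).2.2 p hp rfl
  obtain ⟨c, α, hc, hα, rfl⟩ := hf
  have hval : eval (a y) (∏ H ∈ tangentHyperplanes a S, α H) =
      (∏ c ∈ Λ, c) * eval (a z) (∏ H ∈ tangentHyperplanes a S, α H) := by
    rw [map_prod, map_prod, htan, Finset.prod_image hhinj.injOn, Finset.prod_image hhinj.injOn,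
      ← Finset.prod_mul_distrib]
    refine Finset.prod_congr rfl fun d hd => ?_
    obtain ⟨h1, h2⟩ := hα (h d) (htan ▸ Finset.mem_image_of_mem h hd)
    obtain ⟨m, hm⟩ := exists_dual_eq_eval h1
    have := (h2 _).2 (hyh d)
    rw [hm, map_sub, map_smul, sub_eq_zero, smul_eq_mul] at this
    rw [hm, hm, this]
  rw [map_mul, map_mul, eval_C, eval_C, hval]
  linear_combination c * eval (a z) (∏ H ∈ tangentHyperplanes a S, α H) * hprod

/-- Segre's lemma of tangents. -/
theorem lemma_of_tangents (hli : GeneralPosition a) {t : ℕ}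
    (hn : n + t = Fintype.card K + (r + 1)) {f : Finset (Fin n) → MvPolynomial (Fin (r + 2)) K}
    (hf : ∀ S : Finset (Fin n), S.card = r → IsTangentForm a S (f S)) {D : Finset (Fin n)}
    (hD : D.card + 1 = r) {x y z : Fin n} (hx : x ∉ D) (hy : y ∉ D) (hz : z ∉ D) (hxy : x ≠ y)
    (hyz : y ≠ z) (hxz : x ≠ z) :
    eval (a y) (f (insert x D)) * eval (a z) (f (insert y D)) * eval (a x) (f (insert z D)) =
      (-1) ^ (t + 1) * (eval (a z) (f (insert x D)) * eval (a x) (f (insert y D)) *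
        eval (a y) (f (insert z D))) := by
  set T := insert x (insert y (insert z D)) with hT
  have hTc : T.card = r + 2 := by
    rw [hT, Finset.card_insert_of_notMem (by simp [hxy, hxz, hx]),
      Finset.card_insert_of_notMem (by simp [hyz, hy]), Finset.card_insert_of_notMem hz]
    omega
  have hcard : ∀ {w}, w ∉ D → (insert w D).card = r := fun hw => by
    rw [Finset.card_insert_of_notMem hw, hD]
  have hdual : ∀ w, ∃ l : Module.Dual K (Fin (r + 2) → K),
      ∀ i ∈ T, l (a i) = if i = w then 1 else 0 := fun w =>
    hli.exists_dual hTc.le fun i => if i = w then 1 else 0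
  obtain ⟨lx, hlx⟩ := hdual x
  obtain ⟨ly, hly⟩ := hdual y
  obtain ⟨lz, hlz⟩ := hdual z
  have hxT : x ∈ T := by simp [hT]
  have hyT : y ∈ T := by simp [hT]
  have hzT : z ∈ T := by simp [hT]
  have hDT : ∀ i ∈ D, i ∈ T := fun i hi => by simp [hT, hi]
  have key : ∀ {u v w : Fin n}, u ∉ D → v ∉ D → w ∉ D → u ≠ v → v ≠ w → u ≠ w →
      u ∈ T → v ∈ T → w ∈ T → ∀ {lv lw : Module.Dual K (Fin (r + 2) → K)},
      (∀ i ∈ T, lv (a i) = if i = v then 1 else 0) →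
      (∀ i ∈ T, lw (a i) = if i = w then 1 else 0) →
      insert v (insert w (insert u D)) = T →
      eval (a v) (f (insert u D)) * ∏ p ∈ Tᶜ, (-(lw (a p)) / lv (a p)) =
        -eval (a w) (f (insert u D)) := by
    intro u v w hu hv hw huv hvw huw huT hvT hwT lv lw hlv hlw hT'
    have hvan : ∀ {s : Fin n} {l : Module.Dual K (Fin (r + 2) → K)}, s ∉ D → u ≠ s →
        (∀ i ∈ T, l (a i) = if i = s then 1 else 0) → ∀ i ∈ insert u D, l (a i) = 0 := by
      intro s l hs hus hl i hi
      rcases Finset.mem_insert.1 hi with rfl | hi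
      · rw [hl _ huT, if_neg hus]
      · rw [hl _ (hDT i hi), if_neg]
        rintro rfl
        exact hs hi
    rw [← hT']
    refine (hf _ (hcard hu)).eval_mul_prod hli (hcard hu) (by simp [huv.symm, hv])
      (by simp [huw.symm, hw]) hvw (hvan hv huv hlv) (hvan hw huw hlw) ?_ ?_ ?_ ?_
    · simp [hlv v hvT]
    · simp [hlv w hwT, hvw.symm]
    · simp [hlw w hwT]
    · simp [hlw v hvT, hvw]
  have e1 := key hx hy hz hxy hyz hxz hxT hyT hzT hly hlz (by
    rw [hT]; ext i; simp only [Finset.mem_insert]; tauto)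
  have e2 := key hy hz hx hyz hxz.symm hxy.symm hyT hzT hxT hlz hlx (by
    rw [hT]; ext i; simp only [Finset.mem_insert]; tauto)
  have e3 := key hz hx hy hxz.symm hxy hyz.symm hzT hxT hyT hlx hly hT.symm
  have hne : ∀ {w : Fin n} {l : Module.Dual K (Fin (r + 2) → K)}, w ∈ T →
      (∀ i ∈ T, l (a i) = if i = w then 1 else 0) → ∀ p ∈ Tᶜ, l (a p) ≠ 0 := by
    intro w l hw hl p hp
    refine hli.dual_ne_zero (U := T.erase w) ?_ (by rw [Finset.card_erase_of_mem hw, hTc]; rfl)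
      ?_ (fun h => Finset.mem_compl.1 hp (Finset.mem_of_mem_erase h))
    · rintro rfl
      simpa using hl w hw
    · intro i hi
      rw [hl i (Finset.mem_of_mem_erase hi), if_neg (Finset.ne_of_mem_erase hi)]
  -- Around the triangle the coordinates cancel and only signs remain.
  have hprod : (∏ p ∈ Tᶜ, (-(lz (a p)) / ly (a p))) * (∏ p ∈ Tᶜ, (-(lx (a p)) / lz (a p))) *
      (∏ p ∈ Tᶜ, (-(ly (a p)) / lx (a p))) = (-1) ^ Tᶜ.card := by
    rw [← Finset.prod_mul_distrib, ← Finset.prod_mul_distrib, ← Finset.prod_const]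
    refine Finset.prod_congr rfl fun p hp => ?_
    have h1 := hne hxT hlx p hp
    have h2 := hne hyT hly p hp
    have h3 := hne hzT hlz p hp
    field_simp
  -- The exponents add up to `q`, and `(-1) ^ q = -1` in the field of order `q`, also when `q` is
  -- even.
  have hsign : (-1 : K) ^ Tᶜ.card * (-1) ^ (t + 1) = -1 := by
    have hle : T.card ≤ n := by simpa using T.card_le_univ
    rw [← pow_add, Finset.card_compl, Fintype.card_fin, hTc,
      show n - (r + 2) + (t + 1) = Fintype.card K by omega, FiniteField.pow_card]
  have hpm : (-1 : K) ^ Tᶜ.card ≠ 0 := pow_ne_zero _ (by simp)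
  refine mul_right_cancel₀ hpm ?_
  have e := congrArg₂ (· * ·) (congrArg₂ (· * ·) e1 e2) e3
  linear_combination e - (eval (a y) (f (insert x D)) * eval (a z) (f (insert y D)) *
      eval (a x) (f (insert z D))) * hprod - (eval (a z) (f (insert x D)) *
      eval (a x) (f (insert y D)) * eval (a y) (f (insert z D))) * hsign

end LemmaOfTangents

/-! ### The scalars `(±1)^(t+1)` -/

section SignPower

variable (K : Type*) [Field K]

/-- The scalar `(±1)^(t+1)`, as a homomorphism in the sign. -/
def signPow (t : ℕ) : ℤˣ →* K :=
  (powMonoidHom (t + 1)).comp ((Int.castRingHom K).toMonoidHom.comp (Units.coeHom ℤ))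

variable {K}

theorem signPow_apply (t : ℕ) (u : ℤˣ) : signPow K t u = ((u : ℤ) : K) ^ (t + 1) := rfl

theorem signPow_mul_self (t : ℕ) (u : ℤˣ) : signPow K t u * signPow K t u = 1 := by
  rw [← map_mul, Int.units_mul_self, map_one]

theorem signPow_ne_zero (t : ℕ) (u : ℤˣ) : signPow K t u ≠ 0 :=
  left_ne_zero_of_mul_eq_one (signPow_mul_self t u)

theorem signPow_neg (t : ℕ) (u : ℤˣ) : signPow K t (-u) = (-1) ^ (t + 1) * signPow K t u := by
  rw [← neg_one_mul, map_mul]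
  simp [signPow_apply]

end SignPower

/-! ### Scaled families and the symmetry of the prescribed values -/

section ScaledFamilies

variable {K : Type*} [Field K] {r n : ℕ}

theorem mem_firstPoints {i : Fin n} : i ∈ firstPoints r n ↔ (i : ℕ) < r := by
  simp [firstPoints]

theorem card_firstPoints (h : r ≤ n) : (firstPoints r n).card = r := by
  rw [firstPoints, Fin.card_filter_val_lt, min_eq_right h]

theorem exists_isLeast_isGreatest {S : Finset (Fin n)} (hS : S.card = r)
    (hne : S ≠ firstPoints r n) :
    ∃ e b, IsLeast {i | i ∈ firstPoints r n ∧ i ∉ S} e ∧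
      IsGreatest {i | i ∈ S ∧ i ∉ firstPoints r n} b := by
  have hr : (firstPoints r n).card = r := card_firstPoints (by
    simpa [hS] using S.card_le_univ)
  have h1 : (firstPoints r n \ S).Nonempty := by
    rw [Finset.sdiff_nonempty]
    intro h
    exact hne (Finset.eq_of_subset_of_card_le h (by omega)).symm
  have h2 : (S \ firstPoints r n).Nonempty := by
    rw [Finset.sdiff_nonempty]
    intro h
    exact hne (Finset.eq_of_subset_of_card_le h (by omega))
  have h3 := (firstPoints r n \ S).isLeast_min' h1
  have h4 := (S \ firstPoints r n).isGreatest_max' h2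
  rw [Finset.coe_sdiff] at h3 h4
  exact ⟨_, _, h3, h4⟩

/-- Solving a multiplicative recursion along a decreasing partial map. -/
theorem exists_eq_mul_of_decreasing {α : Type*} (d : α → ℕ) (p : α → Prop) (next : α → α)
    (c : α → K) (hd : ∀ S, p S → d (next S) < d S) (hc : ∀ S, p S → c S ≠ 0) :
    ∃ l : α → K, (∀ S, l S ≠ 0) ∧ ∀ S, p S → l S = c S * l (next S) := by
  classical
  let l : α → K := (measure d).wf.fix fun S ih =>
    if h : p S then c S * ih (next S) (hd S h) else 1
  have hl : ∀ S, l S = if p S then c S * l (next S) else 1 := by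
    intro S
    simp only [l]
    rw [WellFounded.fix_eq]
    split_ifs <;> rfl
  refine ⟨l, fun S => ?_, fun S h => by rw [hl S, if_pos h]⟩
  induction S using (measure d).wf.induction with
  | _ S ih =>
    rw [hl]
    split_ifs with h
    · exact mul_ne_zero (hc S h) (ih _ (hd S h))
    · exact one_ne_zero

/-- Arbitrary tangent forms are rescaled. Each condition expresses the scalar of `S` by that of a
set with one point fewer outside `E`, and the values involved are nonzero, so the scalars are found
recursively. -/
theorem exists_isScaledTangentFamily [Finite K] (a : Fin n → Fin (r + 2) → K) (t : ℕ) :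
    ∃ f, IsScaledTangentFamily a t f := by
  choose g hg using exists_isTangentForm a
  let p : Finset (Fin n) → Fin n → Fin n → Prop := fun S e b =>
    IsLeast {i | i ∈ firstPoints r n ∧ i ∉ S} e ∧ IsGreatest {i | i ∈ S ∧ i ∉ firstPoints r n} b
  -- The pair consists of the next set and the required ratio, well defined because least and
  -- greatest elements are unique; `(S, 0)` is a dummy where no exchange is prescribed.
  have hq : ∀ S, ∃ q : Finset (Fin n) × K, ∀ e b, p S e b →
      q = (insert e (S.erase b), signPow K t (snocSign S e) *
        eval (a b) (g (insert e (S.erase b))) / eval (a e) (g S)) := by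
    intro S
    by_cases h : ∃ e b, p S e b
    · obtain ⟨e, b, he, hb⟩ := h
      refine ⟨(insert e (S.erase b), signPow K t (snocSign S e) *
        eval (a b) (g (insert e (S.erase b))) / eval (a e) (g S)), fun e' b' h' => ?_⟩
      rw [he.unique h'.1, hb.unique h'.2]
    · push Not at h
      exact ⟨(S, 0), fun e b h' => absurd h' (h e b)⟩
  choose q hq using hq
  have hne : ∀ {S e b}, p S e b → e ≠ b := by
    rintro S e b ⟨he, hb⟩ rfl
    exact hb.1.2 he.1.1
  obtain ⟨l, hl0, hl⟩ := exists_eq_mul_of_decreasing (fun S => (S \ firstPoints r n).card)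
    (fun S => ∃ e b, p S e b) (fun S => (q S).1) (fun S => (q S).2)
    (by
      rintro S ⟨e, b, h⟩
      rw [hq S e b h]
      refine Finset.card_lt_card ⟨?_, fun hsub => ?_⟩
      · intro i hi
        simp only [Finset.mem_sdiff, Finset.mem_insert, Finset.mem_erase] at hi ⊢
        rcases hi.1 with rfl | h'
        · exact absurd h.1.1.1 hi.2
        · exact ⟨h'.2, hi.2⟩
      · have := hsub (Finset.mem_sdiff.2 h.2.1)
        simp [(hne h).symm] at this)
    (by
      rintro S ⟨e, b, h⟩
      rw [hq S e b h]
      refine div_ne_zero (mul_ne_zero (signPow_ne_zero _ _) ((hg _).eval_ne_zero ?_))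
        ((hg _).eval_ne_zero h.1.1.2)
      simp [(hne h).symm])
  refine ⟨fun S => C (l S) * g S, fun S _ => (hg S).C_mul (hl0 S), ?_⟩
  intro S hS e b he hb
  have h1 := hl S ⟨e, b, he, hb⟩
  have h2 := (hg S).eval_ne_zero he.1.2
  simp only [hq S e b ⟨he, hb⟩] at h1
  rw [map_mul, map_mul, eval_C, eval_C, h1, ← snocSign_eq hS, ← signPow_apply]
  field_simp

variable {a : Fin n → Fin (r + 2) → K} {t : ℕ}
  {f : Finset (Fin n) → MvPolynomial (Fin (r + 2)) K}

/-- The value of the tangent form of `C \ {x}` at `x`, with the sign of the sequence consisting of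
`C \ {x}` followed by `x`. -/
noncomputable def signedValue (a : Fin n → Fin (r + 2) → K) (t : ℕ)
    (f : Finset (Fin n) → MvPolynomial (Fin (r + 2)) K) (C : Finset (Fin n)) (x : Fin n) : K :=
  signPow K t (snocSign (C.erase x) x) * eval (a x) (f (C.erase x))

theorem signedValue_eq {C S : Finset (Fin n)} {x : Fin n} (h : C.erase x = S) :
    signedValue a t f C x = signPow K t (snocSign S x) * eval (a x) (f S) := by
  rw [signedValue, h]

/-- Once the signs are absorbed, the lemma of tangents is the cyclic relation and the scaling is the
single exchange required by `eq_of_cyclic_of_exchange`. -/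
theorem IsScaledTangentFamily.signedValue_eq_signedValue [Fintype K]
    (hf : IsScaledTangentFamily a t f)
    (hli : GeneralPosition a) (hn : n + t = Fintype.card K + (r + 1)) {C : Finset (Fin n)}
    (hC : C.card = r + 1) {x y : Fin n} (hx : x ∈ C) (hy : y ∈ C) :
    signedValue a t f C x = signedValue a t f C y := by
  have hrn : r ≤ n := by
    have := C.card_le_univ
    rw [Fintype.card_fin] at this
    omega
  refine eq_of_cyclic_of_exchange (card_firstPoints hrn) ?_ ?_ ?_ hC hx hy
  · intro C x hC hx
    refine mul_ne_zero (signPow_ne_zero _ _) ((hf.tangent _ ?_).eval_ne_zero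
      (Finset.notMem_erase _ _))
    rw [Finset.card_erase_of_mem hx, hC]
    rfl
  · intro D x y z hD hx hy hz hxy hyz hxz
    have er : ∀ {u v : Fin n}, u ∉ D → u ≠ v → (insert u (insert v D)).erase u = insert v D :=
      fun hu huv => Finset.erase_insert (by simp [huv, hu])
    have er' : ∀ {u v : Fin n}, v ∉ D → u ≠ v → (insert u (insert v D)).erase v = insert u D :=
      fun hv huv => by rw [Finset.insert_comm, er hv huv.symm]
    have sw : ∀ {u v : Fin n}, u ∉ D → v ∉ D → u ≠ v →
        signPow K t (snocSign D u) * signPow K t (snocSign (insert u D) v) =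
        (-1) ^ (t + 1) * (signPow K t (snocSign D v) * signPow K t (snocSign (insert v D) u)) := by
      intro u v hu hv huv
      rw [← map_mul, snocSign_swap hu hv huv, signPow_neg, map_mul]
    have e1 := sw hx hy hxy
    have e2 := sw hy hz hyz
    have e3 := sw hz hx hxz.symm
    have hT := lemma_of_tangents hli hn hf.tangent hD hx hy hz hxy hyz hxz
    have hε : ((-1 : K) ^ (t + 1)) * (-1) ^ (t + 1) = 1 := by
      rw [← mul_pow]
      simp
    rw [signedValue_eq (er' hy hxy), signedValue_eq (er' hz hyz), signedValue_eq (er hx hxz),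
      signedValue_eq (er hx hxy), signedValue_eq (er hy hyz), signedValue_eq (er' hz hxz)]
    have hx0 := signPow_ne_zero (K := K) t (snocSign D x)
    have hy0 := signPow_ne_zero (K := K) t (snocSign D y)
    have hz0 := signPow_ne_zero (K := K) t (snocSign D z)
    -- The extra factors complete the signs to those of `D` followed by two points. Three
    -- transpositions and the lemma of tangents each contribute `(-1)^(t+1)`, and the four factors
    -- cancel.
    refine mul_left_cancel₀ (mul_ne_zero (mul_ne_zero hx0 hy0) hz0) ?_
    generalize (-1 : K) ^ (t + 1) = ε at *
    calc _ = (signPow K t (snocSign D x) * signPow K t (snocSign (insert x D) y)) *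
          (signPow K t (snocSign D y) * signPow K t (snocSign (insert y D) z)) *
          (signPow K t (snocSign D z) * signPow K t (snocSign (insert z D) x)) *
          (eval (a y) (f (insert x D)) * eval (a z) (f (insert y D)) *
            eval (a x) (f (insert z D))) := by ring
      _ = (ε * ε) * (ε * ε) * (signPow K t (snocSign D x) * signPow K t (snocSign D y) *
          signPow K t (snocSign D z) *
          (signPow K t (snocSign (insert y D) x) * eval (a x) (f (insert y D)) *
          (signPow K t (snocSign (insert z D) y) * eval (a y) (f (insert z D))) *
          (signPow K t (snocSign (insert x D) z) * eval (a z) (f (insert x D))))) := by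
        rw [e1, e2, e3, hT]
        ring
      _ = _ := by rw [hε, one_mul, one_mul]
  · intro S hS hSE
    obtain ⟨e, b, he, hb⟩ := exists_isLeast_isGreatest hS hSE
    have heb : e ≠ b := by
      rintro rfl
      exact hb.1.2 he.1.1
    refine ⟨e, he.1.1, b, hb.1.2, he.1.2, hb.1.1, ?_⟩
    -- As `b` follows all of `E` and is last in `S \ E`, the sign on its side is trivial.
    have hlast : ∀ i ∈ insert e (S.erase b), i < b := by
      intro i hi
      have hbr : r ≤ (b : ℕ) := by simpa [mem_firstPoints] using hb.1.2
      by_cases hiE : i ∈ firstPoints r n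
      · exact Fin.lt_def.2 (lt_of_lt_of_le (mem_firstPoints.1 hiE) hbr)
      · rcases Finset.mem_insert.1 hi with rfl | hi
        · exact absurd he.1.1 hiE
        · obtain ⟨hib, hiS⟩ := Finset.mem_erase.1 hi
          exact lt_of_le_of_ne (hb.2 ⟨hiS, hiE⟩) hib
    rw [signedValue_eq (Finset.erase_insert he.1.2),
      signedValue_eq (Finset.erase_insert_of_ne heb), snocSign_of_forall_lt hlast, map_one,
      one_mul, hf.scaled S hS e b he hb, ← snocSign_eq hS, ← signPow_apply, ← mul_assoc,
      signPow_mul_self, one_mul]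

open Classical in
/-- The values prescribed at the tuples of points of the arc. -/
noncomputable def tangentArray (a : Fin n → Fin (r + 2) → K) (t : ℕ)
    (f : Finset (Fin n) → MvPolynomial (Fin (r + 2)) K) (τ : Fin (r + 1) → Fin n) : K :=
  if Function.Injective τ then
    signPow K t (orderSign fun j : Fin r => τ j.castSucc) *
      eval (a (τ (Fin.last r))) (f (Finset.univ.image fun j : Fin r => τ j.castSucc))
  else 0

theorem tangentArray_of_not_injective {τ : Fin (r + 1) → Fin n} (h : ¬ Function.Injective τ) :
    tangentArray a t f τ = 0 := if_neg h

theorem tangentArray_of_injective {τ : Fin (r + 1) → Fin n} (h : Function.Injective τ) :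
    tangentArray a t f τ =
      signPow K t (orderSign fun j : Fin r => τ j.castSucc) *
        eval (a (τ (Fin.last r))) (f (Finset.univ.image fun j : Fin r => τ j.castSucc)) := if_pos h

/-- This isolates the sign of the whole tuple; the other factor depends only on the underlying set
and the last point, and for a scaled family not even on that point. -/
theorem tangentArray_eq_signedValue {τ : Fin (r + 1) → Fin n} (h : Function.Injective τ) :
    tangentArray a t f τ = signPow K t (orderSign τ) *
      signedValue a t f (Finset.univ.image τ) (τ (Fin.last r)) := by
  have hinit : Function.Injective fun j : Fin r => τ j.castSucc :=
    h.comp (Fin.castSucc_injective r)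
  have hlast : ∀ j : Fin r, τ j.castSucc ≠ τ (Fin.last r) := fun j e =>
    (Fin.castSucc_lt_last j).ne (h e)
  have himg : (Finset.univ.image τ).erase (τ (Fin.last r)) =
      Finset.univ.image fun j : Fin r => τ j.castSucc := by
    ext i
    simp only [Finset.mem_erase, Finset.mem_image, Finset.mem_univ, true_and]
    constructor
    · rintro ⟨hi, j, rfl⟩
      revert hi
      refine Fin.lastCases ?_ (fun j => ?_) j
      · exact fun hi => absurd rfl hi
      · exact fun _ => ⟨j, rfl⟩
    · rintro ⟨j, rfl⟩
      exact ⟨hlast j, _, rfl⟩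
  have hs : orderSign τ = orderSign (fun j : Fin r => τ j.castSucc) *
      snocSign (Finset.univ.image fun j : Fin r => τ j.castSucc) (τ (Fin.last r)) := by
    rw [← orderSign_snoc hinit hlast]
    congr 1
    exact (Fin.snoc_init_self τ).symm
  rw [tangentArray_of_injective h, signedValue_eq himg, hs, map_mul]
  have := signPow_mul_self (K := K) t
    (snocSign (Finset.univ.image fun j : Fin r => τ j.castSucc) (τ (Fin.last r)))
  rw [mul_assoc, ← mul_assoc (signPow K t (snocSign _ _)), this, one_mul]

theorem IsScaledTangentFamily.tangentArray_comp_perm [Fintype K]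
    (hf : IsScaledTangentFamily a t f)
    (hli : GeneralPosition a) (hn : n + t = Fintype.card K + (r + 1))
    (τ : Fin (r + 1) → Fin n) (σ : Equiv.Perm (Fin (r + 1))) :
    tangentArray a t f (τ ∘ σ) =
      signPow K t (Equiv.Perm.sign σ) * tangentArray a t f τ := by
  by_cases h : Function.Injective τ
  · have himg : Finset.univ.image (τ ∘ σ) = Finset.univ.image τ := by
      rw [← Finset.image_image, Finset.image_univ_equiv]
    rw [tangentArray_eq_signedValue h, tangentArray_eq_signedValue (h.comp σ.injective), himg,
      orderSign_comp_perm h, map_mul, mul_assoc]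
    congr 2
    refine hf.signedValue_eq_signedValue hli hn ?_ (by simp) (by simp)
    rw [Finset.card_image_of_injective _ h, Finset.card_fin]
  · rw [tangentArray_of_not_injective h, mul_zero, tangentArray_of_not_injective]
    exact fun h' => h ((Function.Injective.of_comp_iff' τ σ.bijective).1 h')

theorem isHomogeneous_of_isTangentForm [Fintype K]
    (hli : GeneralPosition a)
    (hn : n + t = Fintype.card K + (r + 1)) {S : Finset (Fin n)} (hS : S.card = r)
    {g : MvPolynomial (Fin (r + 2)) K} (hg : IsTangentForm a S g) : g.IsHomogeneous t := by
  have h := hli.card_tangentHyperplanes hS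
  rw [Nat.card_eq_fintype_card] at h
  have ht : (tangentHyperplanes a S).card = t := by omega
  exact ht ▸ hg.isHomogeneous

theorem snoc_castSucc_fun {α : Type*} (τ : Fin r → α) (l : α) :
    (fun j : Fin r => Fin.snoc (α := fun _ => α) τ l j.castSucc) = τ := by
  funext j
  simp

/-- The prescribed values at the tuples with given first entries are those of a tangent form. -/
theorem IsScaledTangentFamily.tangentArray_snoc [Fintype K] (hf : IsScaledTangentFamily a t f)
    (ht : 1 ≤ t) (hli : GeneralPosition a) (hn : n + t = Fintype.card K + (r + 1))
    {ι : Fin r → Fin n} (hι : Function.Injective ι) (l : Fin n) :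
    tangentArray a t f (Fin.snoc (α := fun _ => Fin n) ι l) =
      signPow K t (orderSign ι) * eval (a l) (f (Finset.univ.image ι)) := by
  -- On a repeated point the array is `0` by definition, and the tangent form vanishes there because
  -- `1 ≤ t`.
  by_cases hl : l ∈ Finset.univ.image ι
  · have hS : (Finset.univ.image ι).card = r := by
      rw [Finset.card_image_of_injective _ hι, Finset.card_fin]
    have hne : (tangentHyperplanes a (Finset.univ.image ι)).Nonempty := by
      have h := hli.card_tangentHyperplanes hS
      rw [Nat.card_eq_fintype_card] at h
      rw [← Finset.card_pos]
      omega
    rw [(hf.tangent _ hS).eval_eq_zero hne hl, mul_zero, tangentArray_of_not_injective]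
    obtain ⟨i, -, rfl⟩ := Finset.mem_image.1 hl
    intro h
    refine (Fin.castSucc_lt_last i).ne (h ?_)
    simp
  · rw [tangentArray_of_injective, snoc_castSucc_fun, Fin.snoc_last]
    refine Fin.snoc_injective_of_injective hι ?_
    rintro ⟨i, rfl⟩
    exact hl (Finset.mem_image_of_mem _ (Finset.mem_univ _))

/-- Every slice of the prescribed array consists of the values of a form of degree `t`. -/
theorem IsScaledTangentFamily.exists_form_slice [Fintype K]
    (hf : IsScaledTangentFamily a t f) (ht : 1 ≤ t)
    (hli : GeneralPosition a) (hn : n + t = Fintype.card K + (r + 1)) (j : Fin (r + 1))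
    (τ : Fin (r + 1) → Fin n) :
    ∃ φ : MvPolynomial (Fin (r + 2)) K, φ.IsHomogeneous t ∧
      ∀ l, tangentArray a t f (Function.update τ j l) = eval (a l) φ := by
  have hlast : ∀ τ : Fin (r + 1) → Fin n, ∃ φ : MvPolynomial (Fin (r + 2)) K,
      φ.IsHomogeneous t ∧
      ∀ l, tangentArray a t f (Function.update τ (Fin.last r) l) = eval (a l) φ := by
    intro τ
    set ι : Fin r → Fin n := fun j => τ j.castSucc with hι
    have hu : ∀ l, Function.update τ (Fin.last r) l = Fin.snoc (α := fun _ => Fin n) ι l := by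
      intro l
      funext i
      refine Fin.lastCases ?_ (fun i => ?_) i
      · simp
      · simp [hι, (Fin.castSucc_lt_last i).ne]
    simp only [hu]
    by_cases hinj : Function.Injective ι
    · have hS : (Finset.univ.image ι).card = r := by
        rw [Finset.card_image_of_injective _ hinj, Finset.card_fin]
      have htan := hf.tangent _ hS
      refine ⟨C (signPow K t (orderSign ι)) * f (Finset.univ.image ι), ?_, fun l => ?_⟩
      · simpa using (isHomogeneous_C (Fin (r + 2)) (signPow K t (orderSign ι))).mul
          (isHomogeneous_of_isTangentForm hli hn hS htan)
      · rw [map_mul, eval_C, hf.tangentArray_snoc ht hli hn hinj]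
    · refine ⟨0, isHomogeneous_zero _ _ _, fun l => ?_⟩
      rw [map_zero, tangentArray_of_not_injective]
      intro h
      refine hinj ?_
      have := h.comp (Fin.castSucc_injective r)
      rwa [show Fin.snoc (α := fun _ => Fin n) ι l ∘ Fin.castSucc = ι from
        snoc_castSucc_fun ι l] at this
  -- The symmetry of the array moves slot `j` to the last place, at the cost of a sign.
  obtain ⟨φ, hφ, h⟩ := hlast (τ ∘ Equiv.swap j (Fin.last r))
  refine ⟨C (signPow K t (Equiv.Perm.sign (Equiv.swap j (Fin.last r)))) * φ, ?_, fun l => ?_⟩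
  · simpa using (isHomogeneous_C (Fin (r + 2)) _).mul hφ
  · rw [map_mul, eval_C, ← h, ← hf.tangentArray_comp_perm hli hn, Function.update_comp_equiv]
    congr 2
    · funext i
      simp
    · simp

end ScaledFamilies

/-! ### Uniqueness and existence of the form -/

section TensorForms

variable {K : Type*} [Field K] {r n t : ℕ} {a : Fin n → Fin (r + 2) → K}
  {f : Finset (Fin n) → MvPolynomial (Fin (r + 2)) K}

/-- Property (i) gives the values at tuples of distinct points, and (ii) gives the others; (iii)
plays no part. -/
theorem IsTensorForm.evalAll_eq {F : TuplePoly K r} (hF : IsTensorForm a t f F)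
    (τ : Fin (r + 1) → Fin n) : evalAll (fun j => a (τ j)) F = tangentArray a t f τ := by
  by_cases h : Function.Injective τ
  · have h1 := (mem_Phi.1 (hF.eval_subset (fun j => τ j.castSucc)
      (h.comp (Fin.castSucc_injective r)))).2 (τ (Fin.last r))
    rw [map_sub, sub_eq_zero, eval_evalInit, map_mul, eval_C] at h1
    rw [tangentArray_of_injective h, signPow_apply, ← h1]
    congr 1
    exact (Fin.snoc_init_self (fun j => a (τ j))).symm
  · rw [tangentArray_of_not_injective h, hF.eval_repeated τ h]

theorem IsTensorForm.sub_mem {F G : TuplePoly K r} (hF : IsTensorForm a t f F)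
    (hG : IsTensorForm a t f G) : F - G ∈ PhiIdeal a t := by
  have h := hF.homogeneous.sub_C_mul hG.homogeneous 1
  rw [map_one, one_mul] at h
  refine h.mem_PhiIdeal fun τ => ?_
  have h1 := hF.evalAll_eq τ
  rw [← hG.evalAll_eq τ] at h1
  rw [evalAll, map_sub, sub_eq_zero]
  exact h1

theorem IsScaledTangentFamily.exists_isTensorForm [Fintype K] (hf : IsScaledTangentFamily a t f)
    (ht : 1 ≤ t) (hli : GeneralPosition a) (hn : n + t = Fintype.card K + (r + 1)) :
    ∃ F : TuplePoly K r, IsTensorForm a t f F := by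
  obtain ⟨g, hg, hg'⟩ := exists_interpolating_forms a t
  set F := tensorSum g (tangentArray a t f) with hFdef
  have hF : IsMultiHomogeneous F t := isMultiHomogeneous_tensorSum hg _
  have hval : ∀ τ : Fin (r + 1) → Fin n,
      evalAll (fun j => a (τ j)) F = tangentArray a t f τ :=
    evalAll_tensorSum hg' (hf.exists_form_slice ht hli hn)
  refine ⟨F, hF, fun τ hτ => ?_, fun τ hτ => ?_, fun σ => ?_⟩
  · have hS : (Finset.univ.image τ).card = r := by
      rw [Finset.card_image_of_injective _ hτ, Finset.card_fin]
    rw [← signPow_apply, mem_Phi]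
    refine ⟨?_, fun l => ?_⟩
    · rw [← smul_eq_C_mul]
      exact (homogeneousSubmodule _ K t).sub_mem (isHomogeneous_evalInit_tensorSum hg _ _)
        ((homogeneousSubmodule _ K t).smul_mem _
          (isHomogeneous_of_isTangentForm hli hn hS (hf.tangent _ hS)))
    · have hsnoc : Fin.snoc (α := fun _ => Fin (r + 2) → K) (fun j => a (τ j)) (a l) =
          fun j => a (Fin.snoc (α := fun _ => Fin n) τ l j) := by
        funext j
        refine Fin.lastCases ?_ (fun j => ?_) j <;> simp
      rw [map_sub, sub_eq_zero, eval_evalInit, hsnoc, hval, map_mul, eval_C,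
        hf.tangentArray_snoc ht hli hn hτ]
  · rw [hval, tangentArray_of_not_injective hτ]
  -- The difference is again multihomogeneous, so (iii) only has to be checked on values, where it
  -- is the symmetry of the array.
  · refine ((hF.permute σ).sub_C_mul hF _).mem_PhiIdeal fun τ => ?_
    have h1 : evalAll (fun j => a (τ j)) (permute σ F) = tangentArray a t f (τ ∘ σ) := by
      rw [evalAll_permute]
      exact hval (τ ∘ σ)
    rw [hf.tangentArray_comp_perm hli hn, ← hval τ, signPow_apply] at h1
    rw [evalAll, map_sub, map_mul, eval_C, sub_eq_zero]
    exact h1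

end TensorForms

end Arc

open Arc in
theorem theorem1 {K : Type*} [Field K] [Fintype K] (r t n : ℕ) (ht : 1 ≤ t)
    (A : Set (ℙ K (Fin (r + 2) → K))) (hA : IsArc A)
    (p : Fin n ≃ A) (hn : n + t = Fintype.card K + (r + 1))
    (a : Fin n → Fin (r + 2) → K) (ha : ∀ i, a i ≠ 0)
    (hp : ∀ i, Projectivization.mk K (a i) (ha i) = p i)
    (hsmall : n < r + 2 → LinearIndependent K a) :
    (∃ f, IsScaledTangentFamily a t f) ∧
    ∀ f, IsScaledTangentFamily a t f →
      (∃ F : TuplePoly K r, IsTensorForm a t f F) ∧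
      ∀ F G : TuplePoly K r, IsTensorForm a t f F → IsTensorForm a t f G →
        F - G ∈ PhiIdeal a t := by
  have hli := hA.generalPosition p ha hp hsmall
  exact ⟨exists_isScaledTangentFamily a t, fun f hf =>
    ⟨hf.exists_isTensorForm ht hli hn, fun F G hF hG => hF.sub_mem hG⟩⟩
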